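/- Let $\Bbbk$ be a field of characteristic $0$ and write $\otimes=\otimes_{\Bbbk}$. For a $\Bbbk$-algebra $A$, a double bracket on $A$ (over $\Bbbk$) is a $\Bbbk$-bilinear map $\{\!\{-,-\}\!\}:A\times A\to A\otimes A$ with $\{\!\{a,b\}\!\}=-\{\!\{b,a\}\!\}^\circ$, where $(x\otimes y)^\circ=y\otimes x$, and $\{\!\{a,bc\}\!\}=\{\!\{a,b\}\!\}\,c+b\,\{\!\{a,c\}\!\}$, where $b(d'\otimes d'')c=bd'\otimes d''c$. Its triple bracket is $$\{\!\{a,b,c\}\!\}=\{\!\{a,\{\!\{b,c\}\!\}'\}\!\}\otimes\{\!\{b,c\}\!\}''+\tau\big(\{\!\{b,\{\!\{c,a\}\!\}'\}\!\}\otimes\{\!\{c,a\}\!\}''\big)+\tau^2\big(\{\!\{c,\{\!\{a,b\}\!\}'\}\!\}\otimes\{\!\{a,b\}\!\}''\big),$$ with $\tau(x\otimes y\otimes z)=z\otimes x\otimes y$. The double bracket is quasi-Poisson if for all $a,b,c\in A$ $$\{\!\{a,b,c\}\!\}=\tfrac14\big(ca\otimes b\otimes 1-ca\otimes 1\otimes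 b-c\otimes ab\otimes 1+c\otimes a\otimes b-a\otimes b\otimes c+a\otimes 1\otimes bc+1\otimes ab\otimes c-1\otimes a\otimes bc\big).$$ A multiplicative moment map is an invertible $\Phi\in A$ with $\{\!\{\Phi,a\}\!\}=\frac12(a\otimes\Phi-1\otimes\Phi a+a\Phi\otimes 1-\Phi\otimes a)$ for all $a\in A$; then $(A,\{\!\{-,-\}\!\},\Phi)$ is called quasi-Hamiltonian. Let $\Sigma$ be a compact connected oriented surface of genus $g\ge 0$ with $r+1\ge 1$ boundary components, let $*\in\partial\Sigma$, and fix a standard presentation of $\pi_1(\Sigma,*)$, that is, generators $\alpha_i,\beta_i$ $(1\le i\le g)$, $\gamma_k$ $(1\le k\le r)$ and $\Phi$ subject to the single relation $$[\alpha_1,\beta_1]\cdots[\alpha_g,\beta_g]\,\gamma_1\cdots\gamma_r=\Phi,\qquad [\alpha,\beta]=\alpha\beta\alpha^{-1}\beta^{-1},$$ where $\Phi$ is the class of a loop around the boundary component containing $*$. **Theorem.** The algebra $A=\Bbbk\pi_1(\Sigma,*)$ has a unique double bracket such that: - for $1\le i\le g$: $\{\!\{\alpha_i,\alpha_i\}\!\}=\frac12(\alpha_i^2\otimes1-1\otimes\alpha_i^2)$,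 $\{\!\{\beta_i,\beta_i\}\!\}=-\frac12(\beta_i^2\otimes1-1\otimes\beta_i^2)$, and $\{\!\{\alpha_i,\beta_i\}\!\}=\frac12(\beta_i\alpha_i\otimes1+1\otimes\alpha_i\beta_i-\alpha_i\otimes\beta_i+\beta_i\otimes\alpha_i)$; - for $1\le k\le r$: $\{\!\{\gamma_k,\gamma_k\}\!\}=\frac12(\gamma_k^2\otimes1-1\otimes\gamma_k^2)$; - $\{\!\{x,y\}\!\}=\frac12(yx\otimes1+1\otimes xy-x\otimes y-y\otimes x)$ whenever $x\in\{\alpha_i,\beta_i\}$ and $y\in\{\alpha_j,\beta_j\}$ with $i<j$, or $x\in\{\alpha_i,\beta_i\}$ and $y=\gamma_k$, or $x=\gamma_k$ and $y=\gamma_l$ with $k<l$. This double bracket is quasi-Poisson. For $a=\alpha_i,\beta_i,\gamma_k$ one has $\{\!\{\Phi,a\}\!\}=\frac12(a\otimes\Phi-1\otimes\Phi a+a\Phi\otimes1-\Phi\otimes a)$; in particular $\Phi$ is a multiplicative moment map and $A$ is quasi-Hamiltonian. More generally, the same holds for the group algebra $\Bbbk\pi$ of any group $\pi$ with a presentation by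 such generators and this single relation. -/

import Mathlib

open scoped TensorProduct Manifold ContDiff

/-! ## Double brackets, quasi-Poisson property, multiplicative moment maps -/

section DoubleBrackets

variable {k A : Type*} [Field k] [Ring A] [Algebra k A] {ι : Type*}

/-- A `B`-linear double bracket on the `k`-algebra `A`, where `B` is the span of the family `e`:
a `k`-bilinear map `br : A × A → A ⊗ A` vanishing when one argument lies in `B`, cyclically
antisymmetric, and a derivation in its last argument for the outer bimodule structure
`b (d' ⊗ d'') c = b d' ⊗ d'' c`. -/
structure IsDoubleBracket (e : ι → A) (br : A →ₗ[k] A →ₗ[k] A ⊗[k] A) : Prop where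
  base_left : ∀ s a, br (e s) a = 0
  base_right : ∀ s a, br a (e s) = 0
  antisymm : ∀ a b, br a b = - TensorProduct.comm k A A (br b a)
  leibniz : ∀ a b c, br a (b * c) = br a b * (1 ⊗ₜ[k] c) + (b ⊗ₜ[k] 1) * br a c

/-- The cyclic permutation `a₁ ⊗ a₂ ⊗ a₃ ↦ a₃ ⊗ a₁ ⊗ a₂`. -/
noncomputable def cyc (k A : Type*) [Field k] [Ring A] [Algebra k A] :
    (A ⊗[k] A) ⊗[k] A →ₗ[k] (A ⊗[k] A) ⊗[k] A :=
  (TensorProduct.assoc k A A A).symm.toLinearMap ∘ₗ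
    (TensorProduct.comm k (A ⊗[k] A) A).toLinearMap

theorem cyc_tmul (a b c : A) : cyc k A (a ⊗ₜ[k] b ⊗ₜ[k] c) = c ⊗ₜ[k] a ⊗ₜ[k] b := rfl

/-- The triple bracket of `br`: with `T a d = br a d' ⊗ d''`,
`T a (br b c) + cyc (T b (br c a)) + cyc² (T c (br a b))`. -/
noncomputable def tripleBracket (br : A →ₗ[k] A →ₗ[k] A ⊗[k] A) (a b c : A) :
    (A ⊗[k] A) ⊗[k] A :=
  LinearMap.rTensor A (br a) (br b c)
    + cyc k A (LinearMap.rTensor A (br b) (br c a))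
    + cyc k A (cyc k A (LinearMap.rTensor A (br c) (br a b)))

/-- A double quasi-Poisson bracket on `A` over `B = ⊕ₛ k eₛ`, where `(eₛ)` is a finite complete
family of orthogonal idempotents of `A`. -/
structure IsDoubleQuasiPoisson [Fintype ι] (e : ι → A) (br : A →ₗ[k] A →ₗ[k] A ⊗[k] A) :
    Prop where
  idempotents : CompleteOrthogonalIdempotents e
  bracket : IsDoubleBracket e br
  quasiPoisson : ∀ a b c : A, tripleBracket br a b c = (1 / 4 : k) • ∑ s,
    ((c * e s * a) ⊗ₜ[k] (e s * b) ⊗ₜ[k] (e s)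
      - (c * e s * a) ⊗ₜ[k] (e s) ⊗ₜ[k] (b * e s)
      - (c * e s) ⊗ₜ[k] (a * e s * b) ⊗ₜ[k] (e s)
      + (c * e s) ⊗ₜ[k] (a * e s) ⊗ₜ[k] (b * e s)
      - (e s * a) ⊗ₜ[k] (e s * b) ⊗ₜ[k] (e s * c)
      + (e s * a) ⊗ₜ[k] (e s) ⊗ₜ[k] (b * e s * c)
      + (e s) ⊗ₜ[k] (a * e s * b) ⊗ₜ[k] (e s * c)
      - (e s) ⊗ₜ[k] (a * e s) ⊗ₜ[k] (b * e s * c))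

/-- `Φ` is a multiplicative moment map for `br` over `B = ⊕ₛ k eₛ`: it is invertible, it is the
sum of its components `Φₛ = eₛ Φ eₛ`, and each `Φₛ` satisfies the moment map equation. -/
structure IsMultiplicativeMomentMap [Fintype ι] (e : ι → A)
    (br : A →ₗ[k] A →ₗ[k] A ⊗[k] A) (Φ : A) : Prop where
  isUnit : IsUnit Φ
  diagonal : Φ = ∑ s, e s * Φ * e s
  moment : ∀ s a, br (e s * Φ * e s) a = (1 / 2 : k) •
    ((a * e s) ⊗ₜ[k] (e s * Φ * e s) - (e s) ⊗ₜ[k] (e s * Φ * e s * a)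
      + (a * (e s * Φ * e s)) ⊗ₜ[k] (e s) - (e s * Φ * e s) ⊗ₜ[k] (e s * a))

/-- `(A, br, Φ)` is a quasi-Hamiltonian algebra over `B = ⊕ₛ k eₛ`. -/
structure IsQuasiHamiltonian [Fintype ι] (e : ι → A)
    (br : A →ₗ[k] A →ₗ[k] A ⊗[k] A) (Φ : A) : Prop where
  doubleQuasiPoisson : IsDoubleQuasiPoisson e br
  momentMap : IsMultiplicativeMomentMap e br Φ

/-- `½ (y x ⊗ 1 + 1 ⊗ x y - x ⊗ y - y ⊗ x)`. -/
noncomputable def fusionTerm (k : Type*) {A : Type*} [Field k] [Ring A] [Algebra k A] (x y : A) :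
    A ⊗[k] A :=
  (1 / 2 : k) • ((y * x) ⊗ₜ[k] 1 + 1 ⊗ₜ[k] (x * y) - x ⊗ₜ[k] y - y ⊗ₜ[k] x)

/-- The prescribed values of the (rescaled) Massuyeau–Turaev double bracket on generators
`αᵢ, βᵢ, γⱼ`. -/
structure HasMassuyeauTuraevValues {g r : ℕ} (α β : Fin g → A) (γ : Fin r → A)
    (br : A →ₗ[k] A →ₗ[k] A ⊗[k] A) : Prop where
  alpha_alpha : ∀ i, br (α i) (α i) =
    (1 / 2 : k) • ((α i ^ 2) ⊗ₜ[k] 1 - 1 ⊗ₜ[k] (α i ^ 2))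
  beta_beta : ∀ i, br (β i) (β i) =
    -((1 / 2 : k) • ((β i ^ 2) ⊗ₜ[k] 1 - 1 ⊗ₜ[k] (β i ^ 2)))
  alpha_beta : ∀ i, br (α i) (β i) =
    (1 / 2 : k) • ((β i * α i) ⊗ₜ[k] 1 + 1 ⊗ₜ[k] (α i * β i)
      - (α i) ⊗ₜ[k] (β i) + (β i) ⊗ₜ[k] (α i))
  handle_handle : ∀ i j, i < j → ∀ x ∈ ({α i, β i} : Set A), ∀ y ∈ ({α j, β j} : Set A),
    br x y = fusionTerm k x y
  handle_gamma : ∀ i l, ∀ x ∈ ({α i, β i} : Set A), br x (γ l) = fusionTerm k x (γ l)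
  gamma_gamma : ∀ l, br (γ l) (γ l) =
    (1 / 2 : k) • ((γ l ^ 2) ⊗ₜ[k] 1 - 1 ⊗ₜ[k] (γ l ^ 2))
  gamma_gamma' : ∀ l m, l < m → br (γ l) (γ m) = fusionTerm k (γ l) (γ m)

end DoubleBrackets

/-! ## The standard presentation -/

/-- The generators `αᵢ, βᵢ` (`1 ≤ i ≤ g`), `γⱼ` (`1 ≤ j ≤ r`) and `Φ`. -/
inductive SurfaceGen (g r : ℕ) : Type
  | alpha (i : Fin g)
  | beta (i : Fin g)
  | gamma (l : Fin r)
  | phi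

/-- The word `[α₁, β₁] ⋯ [α_g, β_g] γ₁ ⋯ γ_r Φ⁻¹`, with `[a, b] = a b a⁻¹ b⁻¹`. -/
def surfaceRelator (g r : ℕ) : FreeGroup (SurfaceGen g r) :=
  let x : SurfaceGen g r → FreeGroup (SurfaceGen g r) := FreeGroup.of
  (List.ofFn fun i : Fin g =>
      x (.alpha i) * x (.beta i) * (x (.alpha i))⁻¹ * (x (.beta i))⁻¹).prod
    * (List.ofFn fun l : Fin r => x (.gamma l)).prod
    * (x .phi)⁻¹

/-- The group generated by `αᵢ, βᵢ, γⱼ, Φ` subject to the single relation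
`[α₁, β₁] ⋯ [α_g, β_g] γ₁ ⋯ γ_r = Φ`. -/
abbrev SurfaceGroup (g r : ℕ) : Type := PresentedGroup {surfaceRelator g r}

/-- For a group `π` with a standard presentation `e` (an isomorphism from the presented group),
the group algebra `k[π]` carries a double bracket, over `B = k`, that is quasi-Poisson and has the
prescribed values on the generators; it is the only double bracket with these values; the bracket
of `Φ` with each generator `αᵢ, βᵢ, γⱼ` is the stated one; and `Φ` is a multiplicative
moment map, so that `k[π]` is quasi-Hamiltonian. -/
def HasStandardQuasiHamiltonianStructure (k : Type*) [Field k] {g r : ℕ} {π : Type*} [Group π]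
    (e : SurfaceGroup g r ≃* π) : Prop :=
  let ofGen : SurfaceGen g r → MonoidAlgebra k π :=
    fun x => MonoidAlgebra.of k π (e (PresentedGroup.of x))
  let α : Fin g → MonoidAlgebra k π := fun i => ofGen (.alpha i)
  let β : Fin g → MonoidAlgebra k π := fun i => ofGen (.beta i)
  let γ : Fin r → MonoidAlgebra k π := fun l => ofGen (.gamma l)
  let Φ : MonoidAlgebra k π := ofGen .phi
  let one : Unit → MonoidAlgebra k π := fun _ => 1
  ∃ br : MonoidAlgebra k π →ₗ[k] MonoidAlgebra k π →ₗ[k]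
      MonoidAlgebra k π ⊗[k] MonoidAlgebra k π,
    IsDoubleQuasiPoisson one br ∧
    HasMassuyeauTuraevValues α β γ br ∧
    (∀ br', IsDoubleBracket one br' → HasMassuyeauTuraevValues α β γ br' → br' = br) ∧
    (∀ a ∈ Set.range α ∪ Set.range β ∪ Set.range γ, br Φ a = (1 / 2 : k) •
      (a ⊗ₜ[k] Φ - 1 ⊗ₜ[k] (Φ * a) + (a * Φ) ⊗ₜ[k] 1 - Φ ⊗ₜ[k] a)) ∧
    IsMultiplicativeMomentMap one br Φ ∧
    IsQuasiHamiltonian one br Φ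

/-! ## Surfaces with boundary -/

/-- The fundamental group with the usual convention that `p * q` is the class of the loop
running first along `p`, then along `q` (Mathlib's `FundamentalGroup` has the opposite product). -/
abbrev LoopGroup (S : Type*) [TopologicalSpace S] (x : S) : Type _ := (FundamentalGroup S x)ᵐᵒᵖ

/-- The class of a loop in the fundamental group. -/
def loopClass {S : Type*} [TopologicalSpace S] {x : S} (p : Path x x) : LoopGroup S x :=
  MulOpposite.op (FundamentalGroup.fromPath (Path.Homotopic.Quotient.mk p))

theorem loopClass_mul {S : Type*} [TopologicalSpace S] {x : S} (p q : Path x x) :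
    loopClass p * loopClass q = loopClass (p.trans q) := rfl

/-- A compact connected oriented smooth surface with non-empty boundary consisting of `n` circles;
the orientation is the one in which all charts of the given atlas are positive. -/
structure IsCompactOrientedSurface (S : Type*) [TopologicalSpace S]
    [ChartedSpace (EuclideanHalfSpace 2) S] (n : ℕ) : Prop where
  t2 : T2Space S
  compact : CompactSpace S
  connected : ConnectedSpace S
  smooth : IsManifold (𝓡∂ 2) ∞ S
  oriented : ∀ c ∈ atlas (EuclideanHalfSpace 2) S, ∀ c' ∈ atlas (EuclideanHalfSpace 2) S,
    ∀ y ∈ ((c.extend (𝓡∂ 2)).symm.trans (c'.extend (𝓡∂ 2))).source,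
      0 < (fderivWithin ℝ (c'.extend (𝓡∂ 2) ∘ (c.extend (𝓡∂ 2)).symm)
        (Set.range (𝓡∂ 2)) y).det
  boundary_nonempty : ((𝓡∂ 2).boundary S).Nonempty
  boundary_components : Nat.card (ConnectedComponents ((𝓡∂ 2).boundary S)) = n

/-- `p` runs once around the boundary component containing its base point. -/
def IsBoundaryLoop {S : Type*} [TopologicalSpace S] [ChartedSpace (EuclideanHalfSpace 2) S]
    {x : S} (p : Path x x) : Prop :=
  Set.InjOn p (Set.Ico 0 1) ∧
    Set.range p = connectedComponentIn ((𝓡∂ 2).boundary S) x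

/-! The relation can be solved for `Φ`, so `π` is free on `αᵢ, βᵢ, γₗ` (`surfaceGroupEquiv`), and
everything reduces to these free generators.

A double bracket is a derivation for the outer bimodule structure in its last argument and for the
inner one in its first. Such twisted derivations on a group algebra are determined by their values
on generators of the group; on free generators the values are arbitrary. The two bimodule structures
commute, so any antisymmetric table of values extends to exactly one double bracket
(`exists_isDoubleBracket`, `IsDoubleBracket.ext_of_closure`).

Both sides of the quasi-Poisson identity are outer derivations in the last argument and are
cyclically invariant, so generators suffice (`IsDoubleBracket.quasiPoisson_of_closure`). There every
bracket is a combination of `yx ⊗ 1`, `1 ⊗ xy`, `x ⊗ y`, `y ⊗ x`, and the identity follows from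
eight quadratic equations between coefficients. These are checked from the linear order `α₁, β₁, …,
α_g, β_g, γ₁, …, γ_r`, the only irregular sign being that of the adjacent pair `αᵢ, βᵢ`.

The moment map equation also needs checking only on generators `a`. In the word for `Φ`, the factors
before the one involving `a` bracket with `a` by `fusionTerm`, the later ones by its negative, and
the factor itself satisfies the moment equation; multiplying such factors preserves that equation
(`moment_boundaryProd`). -/

section GeneralBrackets

open TensorProduct Algebra.TensorProduct

variable {k A : Type*} [Field k] [Ring A] [Algebra k A] {ι : Type*}

/-! ### Double brackets and the flip of tensor factors -/

theorem comm_mul (x y : A ⊗[k] A) : TensorProduct.comm k A A (x * y) =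
    TensorProduct.comm k A A x * TensorProduct.comm k A A y :=
  map_mul (Algebra.TensorProduct.comm k A A) x y

/-- The linear map `x ⊗ y ↦ -y ⊗ x`. -/
noncomputable def negComm (k A : Type*) [Field k] [Ring A] [Algebra k A] :
    A ⊗[k] A →ₗ[k] A ⊗[k] A :=
  -(TensorProduct.comm k A A).toLinearMap

theorem negComm_apply (x : A ⊗[k] A) : negComm k A x = -TensorProduct.comm k A A x := rfl

/-- The flip exchanges the inner and outer bimodule structures, so it turns derivations for one into
derivations for the other. Antisymmetry of a constructed bracket is proved by comparing such
derivations. -/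
theorem negComm_mul_tmul_one (x : A ⊗[k] A) (a : A) :
    negComm k A (x * (a ⊗ₜ[k] 1)) = negComm k A x * (1 ⊗ₜ[k] a) := by
  rw [negComm_apply, negComm_apply, comm_mul, TensorProduct.comm_tmul, neg_mul]

theorem negComm_mul_one_tmul (x : A ⊗[k] A) (a : A) :
    negComm k A (x * (1 ⊗ₜ[k] a)) = negComm k A x * (a ⊗ₜ[k] 1) := by
  rw [negComm_apply, negComm_apply, comm_mul, TensorProduct.comm_tmul, neg_mul]

theorem negComm_tmul_one_mul (x : A ⊗[k] A) (a : A) :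
    negComm k A ((a ⊗ₜ[k] 1) * x) = (1 ⊗ₜ[k] a) * negComm k A x := by
  rw [negComm_apply, negComm_apply, comm_mul, TensorProduct.comm_tmul, mul_neg]

theorem negComm_one_tmul_mul (x : A ⊗[k] A) (a : A) :
    negComm k A ((1 ⊗ₜ[k] a) * x) = (a ⊗ₜ[k] 1) * negComm k A x := by
  rw [negComm_apply, negComm_apply, comm_mul, TensorProduct.comm_tmul, mul_neg]

/-- The map `a ↦ a ⊗ 1 ⊗ 1`. -/
noncomputable def tripleLeft (k A : Type*) [Field k] [Ring A] [Algebra k A] :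
    A →* (A ⊗[k] A) ⊗[k] A where
  toFun a := a ⊗ₜ[k] 1 ⊗ₜ[k] 1
  map_one' := rfl
  map_mul' a b := by simp only [tmul_mul_tmul, mul_one]

/-- The map `a ↦ 1 ⊗ 1 ⊗ a`. -/
noncomputable def tripleRight (k A : Type*) [Field k] [Ring A] [Algebra k A] :
    A →* (A ⊗[k] A) ⊗[k] A where
  toFun a := 1 ⊗ₜ[k] 1 ⊗ₜ[k] a
  map_one' := rfl
  map_mul' a b := by simp only [tmul_mul_tmul, mul_one]

theorem cyc_mul (x y : (A ⊗[k] A) ⊗[k] A) : cyc k A (x * y) = cyc k A x * cyc k A y := by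
  induction x with
  | zero => simp
  | add x x' hx hx' => simp only [add_mul, map_add, hx, hx']
  | tmul x c =>
    induction x with
    | zero => simp
    | add x x' hx hx' => simp only [add_tmul, add_mul, map_add, hx, hx']
    | tmul a b =>
      induction y with
      | zero => simp
      | add y y' hy hy' => simp only [mul_add, map_add, hy, hy']
      | tmul y c' =>
        induction y with
        | zero => simp
        | add y y' hy hy' => simp only [add_tmul, mul_add, map_add, hy, hy']
        | tmul a' b' => simp only [cyc_tmul, tmul_mul_tmul]

theorem cyc_cyc_cyc (x : (A ⊗[k] A) ⊗[k] A) : cyc k A (cyc k A (cyc k A x)) = x := by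
  induction x with
  | zero => simp
  | add x y hx hy => simp only [map_add, hx, hy]
  | tmul x c =>
    induction x with
    | zero => simp
    | add x y hx hy => simp only [add_tmul, map_add, hx, hy]
    | tmul a b => simp only [cyc_tmul]

/-- The value `c' ⊗ c'' , d' ⊗ d'' ↦ c' ⊗ c'' d' ⊗ d''` of the multiplication in the middle. -/
noncomputable def middleMul (x y : A ⊗[k] A) : (A ⊗[k] A) ⊗[k] A :=
  (x ⊗ₜ[k] 1) * (TensorProduct.assoc k A A A).symm (1 ⊗ₜ[k] y)

theorem middleMul_tmul (a b c d : A) :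
    middleMul (a ⊗ₜ[k] b) (c ⊗ₜ[k] d) = a ⊗ₜ[k] (b * c) ⊗ₜ[k] d := by
  simp [middleMul, tmul_mul_tmul]

theorem middleMul_add_left (x x' y : A ⊗[k] A) :
    middleMul (x + x') y = middleMul x y + middleMul x' y := by
  simp only [middleMul, add_tmul, add_mul]

theorem middleMul_add_right (x y y' : A ⊗[k] A) :
    middleMul x (y + y') = middleMul x y + middleMul x y' := by
  simp only [middleMul, tmul_add, mul_add, map_add]

theorem middleMul_neg_left (x y : A ⊗[k] A) : middleMul (-x) y = -middleMul x y := by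
  refine eq_neg_of_add_eq_zero_left ?_
  rw [← middleMul_add_left]
  simp [middleMul]

theorem middleMul_zero_left (y : A ⊗[k] A) : middleMul 0 y = 0 := by simp [middleMul]

theorem middleMul_zero_right (x : A ⊗[k] A) : middleMul x 0 = 0 := by simp [middleMul]

/-! ### Leibniz rules for double and triple brackets -/

namespace IsDoubleBracket

variable {e : ι → A} {br : A →ₗ[k] A →ₗ[k] A ⊗[k] A}

/-- A double bracket is a derivation in its first argument for the inner bimodule structure. -/
theorem leibniz_left (h : IsDoubleBracket e br) (a b c : A) :
    br (a * b) c = (1 ⊗ₜ[k] a) * br b c + br a c * (b ⊗ₜ[k] 1) := by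
  rw [h.antisymm (a * b) c, h.leibniz, map_add, comm_mul, comm_mul, h.antisymm b c,
    h.antisymm a c]
  simp only [TensorProduct.comm_tmul, mul_neg, neg_mul]
  abel

theorem one_right (h : IsDoubleBracket e br) (a : A) : br a 1 = 0 := by
  have := h.leibniz a 1 1
  simpa [← Algebra.TensorProduct.one_def] using this

theorem one_left (h : IsDoubleBracket e br) (a : A) : br 1 a = 0 := by
  rw [h.antisymm, h.one_right]; simp

theorem rTensor_mul_right (a c : A) (x : A ⊗[k] A) :
    LinearMap.rTensor A (br a) (x * (1 ⊗ₜ[k] c)) =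
      LinearMap.rTensor A (br a) x * (1 ⊗ₜ[k] 1 ⊗ₜ[k] c) := by
  induction x with
  | zero => simp
  | add x y hx hy => simp only [add_mul, map_add, hx, hy]
  | tmul u v =>
    simp only [tmul_mul_tmul, LinearMap.rTensor_tmul, mul_one, ← Algebra.TensorProduct.one_def]

theorem rTensor_mul_left' (a c : A) (x : A ⊗[k] A) :
    LinearMap.rTensor A (br a) ((1 ⊗ₜ[k] c) * x) =
      (1 ⊗ₜ[k] 1 ⊗ₜ[k] c) * LinearMap.rTensor A (br a) x := by
  induction x with
  | zero => simp
  | add x y hx hy => simp only [mul_add, map_add, hx, hy]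
  | tmul u v =>
    simp only [tmul_mul_tmul, LinearMap.rTensor_tmul, one_mul, ← Algebra.TensorProduct.one_def]

/-- Since `br a` is only a derivation, moving `c` out leaves a defect, recorded by `middleMul`. It
cancels against the defect in `cyc_rTensor_mul_right`. -/
theorem rTensor_mul_left (h : IsDoubleBracket e br) (a c : A) (x : A ⊗[k] A) :
    LinearMap.rTensor A (br a) ((c ⊗ₜ[k] 1) * x) =
      (c ⊗ₜ[k] 1 ⊗ₜ[k] 1) * LinearMap.rTensor A (br a) x + middleMul (br a c) x := by
  induction x with
  | zero => simp [middleMul_zero_right]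
  | add x y hx hy =>
    simp only [mul_add, map_add, hx, hy, middleMul_add_right]; abel
  | tmul u v =>
    simp only [tmul_mul_tmul, LinearMap.rTensor_tmul, h.leibniz, one_mul, add_tmul]
    rw [add_comm]
    congr 1
    generalize br a c = y
    induction y with
    | zero => simp [middleMul_zero_left]
    | add x y hx hy => simp only [add_mul, add_tmul, hx, hy, middleMul_add_left]
    | tmul y z => simp only [middleMul_tmul, tmul_mul_tmul, mul_one]

theorem cyc_rTensor_mul_right (h : IsDoubleBracket e br) (b c : A) (x : A ⊗[k] A) :
    cyc k A (LinearMap.rTensor A (br b) (x * (c ⊗ₜ[k] 1))) =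
      cyc k A (LinearMap.rTensor A (br b) x) * (1 ⊗ₜ[k] 1 ⊗ₜ[k] c) +
        middleMul (TensorProduct.comm k A A x) (br b c) := by
  induction x with
  | zero => simp [middleMul_zero_left]
  | add x y hx hy =>
    simp only [add_mul, map_add, hx, hy, middleMul_add_left]; abel
  | tmul u v =>
    simp only [tmul_mul_tmul, LinearMap.rTensor_tmul, h.leibniz, mul_one, add_tmul, map_add,
      TensorProduct.comm_tmul]
    congr 1
    · generalize br b u = y
      induction y with
      | zero => simp
      | add x y hx hy => simp only [add_mul, add_tmul, map_add, hx, hy]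
      | tmul y z => simp only [cyc_tmul, tmul_mul_tmul, mul_one]
    · generalize br b c = y
      induction y with
      | zero => simp [middleMul_zero_right]
      | add x y hx hy => simp only [mul_add, add_tmul, map_add, hx, hy, middleMul_add_right]
      | tmul y z => simp only [cyc_tmul, middleMul_tmul, tmul_mul_tmul, one_mul]

theorem cyc_cyc_rTensor_mul (h : IsDoubleBracket e br) (c d : A) (x : A ⊗[k] A) :
    cyc k A (cyc k A (LinearMap.rTensor A (br (c * d)) x)) =
      cyc k A (cyc k A (LinearMap.rTensor A (br c) x)) * (1 ⊗ₜ[k] 1 ⊗ₜ[k] d) +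
      (c ⊗ₜ[k] 1 ⊗ₜ[k] 1) * cyc k A (cyc k A (LinearMap.rTensor A (br d) x)) := by
  induction x with
  | zero => simp
  | add x y hx hy => simp only [add_mul, mul_add, map_add, hx, hy]; abel
  | tmul u v =>
    simp only [LinearMap.rTensor_tmul, h.leibniz_left, add_tmul, map_add]
    rw [add_comm]
    congr 1
    · generalize br c u = y
      induction y with
      | zero => simp
      | add x y hx hy => simp only [add_mul, add_tmul, map_add, hx, hy]
      | tmul y z => simp only [cyc_tmul, tmul_mul_tmul, mul_one]
    · generalize br d u = y
      induction y with
      | zero => simp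
      | add x y hx hy => simp only [mul_add, add_tmul, map_add, hx, hy]
      | tmul y z => simp only [cyc_tmul, tmul_mul_tmul, one_mul]

/-- The triple bracket is a derivation in its last argument for the outer bimodule structure. -/
theorem tripleBracket_leibniz (h : IsDoubleBracket e br) (a b c d : A) :
    tripleBracket br a b (c * d) = tripleBracket br a b c * (1 ⊗ₜ[k] 1 ⊗ₜ[k] d) +
      (c ⊗ₜ[k] 1 ⊗ₜ[k] 1) * tripleBracket br a b d := by
  -- By antisymmetry the two defects are opposite, which is what makes the triple bracket a
  -- derivation.
  have hneg : middleMul (TensorProduct.comm k A A (br c a)) (br b d) =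
      -middleMul (br a c) (br b d) := by
    rw [h.antisymm a c, middleMul_neg_left, neg_neg]
  unfold tripleBracket
  rw [h.leibniz b c d, h.leibniz_left c d a, h.cyc_cyc_rTensor_mul]
  simp only [map_add]
  rw [h.cyc_rTensor_mul_right, h.rTensor_mul_left, rTensor_mul_right, rTensor_mul_left', cyc_mul,
    cyc_tmul, hneg]
  simp only [mul_add, add_mul]
  abel

end IsDoubleBracket

/-! ### The quasi-Poisson identity for quadratic brackets -/

theorem cyc_tripleBracket (br : A →ₗ[k] A →ₗ[k] A ⊗[k] A) (a b c : A) :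
    cyc k A (tripleBracket br b c a) = tripleBracket br a b c := by
  unfold tripleBracket
  simp only [map_add, cyc_cyc_cyc]
  abel

/-- The right hand side of the quasi-Poisson identity over `k`, multiplied by `4`. -/
noncomputable def quasiPoissonTerm (k : Type*) {A : Type*} [Field k] [Ring A] [Algebra k A]
    (a b c : A) : (A ⊗[k] A) ⊗[k] A :=
  (c * a) ⊗ₜ[k] b ⊗ₜ[k] 1 - (c * a) ⊗ₜ[k] 1 ⊗ₜ[k] b - c ⊗ₜ[k] (a * b) ⊗ₜ[k] 1
    + c ⊗ₜ[k] a ⊗ₜ[k] b - a ⊗ₜ[k] b ⊗ₜ[k] c + a ⊗ₜ[k] 1 ⊗ₜ[k] (b * c)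
    + 1 ⊗ₜ[k] (a * b) ⊗ₜ[k] c - 1 ⊗ₜ[k] a ⊗ₜ[k] (b * c)

theorem cyc_quasiPoissonTerm (a b c : A) :
    cyc k A (quasiPoissonTerm k b c a) = quasiPoissonTerm k a b c := by
  unfold quasiPoissonTerm
  simp only [map_add, map_sub, cyc_tmul]
  abel

theorem quasiPoissonTerm_leibniz (a b c d : A) :
    quasiPoissonTerm k a b (c * d) = quasiPoissonTerm k a b c * (1 ⊗ₜ[k] 1 ⊗ₜ[k] d) +
      (c ⊗ₜ[k] 1 ⊗ₜ[k] 1) * quasiPoissonTerm k a b d := by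
  unfold quasiPoissonTerm
  simp only [mul_add, add_mul, mul_sub, sub_mul, tmul_mul_tmul, mul_one, one_mul, mul_assoc]
  abel

/-- `½ (P y x ⊗ 1 + Q 1 ⊗ x y + S x ⊗ y + T y ⊗ x)`. -/
noncomputable def quadraticTerm (P Q S T : k) (x y : A) : A ⊗[k] A :=
  (1 / 2 : k) • (P • ((y * x) ⊗ₜ[k] 1) + Q • (1 ⊗ₜ[k] (x * y)) + S • (x ⊗ₜ[k] y)
    + T • (y ⊗ₜ[k] x))

theorem comm_quadraticTerm (P Q S T : k) (x y : A) :
    TensorProduct.comm k A A (quadraticTerm P Q S T x y) = quadraticTerm Q P S T y x := by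
  unfold quadraticTerm
  simp only [map_smul, map_add, TensorProduct.comm_tmul]
  module

theorem neg_quadraticTerm (P Q S T : k) (x y : A) :
    -quadraticTerm P Q S T x y = quadraticTerm (-P) (-Q) (-S) (-T) x y := by
  unfold quadraticTerm
  module

/-- The `q₂` term drops out because `br a 1 = 0`, and the Leibniz rule splits the `p₂` term on `c *
b`; hence sixteen monomials, eight with `p₂` and four each with `s₂` and `t₂`. -/
theorem IsDoubleBracket.rTensor_quadraticTerm {e : ι → A} {br : A →ₗ[k] A →ₗ[k] A ⊗[k] A}
    (h : IsDoubleBracket e br) {a b c : A} {p₁ q₁ s₁ t₁ p₂ q₂ s₂ t₂ p₃ q₃ s₃ t₃ : k}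
    (h₁ : br a b = quadraticTerm p₁ q₁ s₁ t₁ a b)
    (h₂ : br b c = quadraticTerm p₂ q₂ s₂ t₂ b c)
    (h₃ : br c a = quadraticTerm p₃ q₃ s₃ t₃ c a) :
    LinearMap.rTensor A (br a) (br b c) = (1 / 4 : k) • (
      -(p₂ * p₃) • (1 ⊗ₜ[k] (a * c * b) ⊗ₜ[k] 1) - (p₂ * q₃) • ((c * a) ⊗ₜ[k] b ⊗ₜ[k] 1)
      - (p₂ * s₃) • (a ⊗ₜ[k] (c * b) ⊗ₜ[k] 1) - (p₂ * t₃) • (c ⊗ₜ[k] (a * b) ⊗ₜ[k] 1)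
      + (p₂ * p₁) • ((c * b * a) ⊗ₜ[k] 1 ⊗ₜ[k] 1) + (p₂ * q₁) • (c ⊗ₜ[k] (a * b) ⊗ₜ[k] 1)
      + (p₂ * s₁) • ((c * a) ⊗ₜ[k] b ⊗ₜ[k] 1) + (p₂ * t₁) • ((c * b) ⊗ₜ[k] a ⊗ₜ[k] 1)
      + (s₂ * p₁) • ((b * a) ⊗ₜ[k] 1 ⊗ₜ[k] c) + (s₂ * q₁) • (1 ⊗ₜ[k] (a * b) ⊗ₜ[k] c)
      + (s₂ * s₁) • (a ⊗ₜ[k] b ⊗ₜ[k] c) + (s₂ * t₁) • (b ⊗ₜ[k] a ⊗ₜ[k] c)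
      - (t₂ * p₃) • (1 ⊗ₜ[k] (a * c) ⊗ₜ[k] b) - (t₂ * q₃) • ((c * a) ⊗ₜ[k] 1 ⊗ₜ[k] b)
      - (t₂ * s₃) • (a ⊗ₜ[k] c ⊗ₜ[k] b) - (t₂ * t₃) • (c ⊗ₜ[k] a ⊗ₜ[k] b)) := by
  have h₃' : br a c = quadraticTerm (-q₃) (-p₃) (-s₃) (-t₃) a c := by
    rw [h.antisymm, h₃, comm_quadraticTerm, neg_quadraticTerm]
  have h₄ : (1 / 4 : k) = (1 / 2) * (1 / 2) := by rw [one_div_mul_one_div]; norm_num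
  rw [h₂, quadraticTerm]
  simp only [map_smul, map_add, LinearMap.rTensor_tmul, h.leibniz, h.one_right, h₁, h₃', zero_tmul,
    smul_zero]
  unfold quadraticTerm
  simp only [add_tmul, ← smul_tmul', mul_add, add_mul, smul_mul_assoc, mul_smul_comm, tmul_mul_tmul,
    one_mul, mul_one, smul_add, smul_smul, h₄, mul_assoc]
  module

/-- The quasi-Poisson identity for three elements whose brackets are of the form
`quadraticTerm`. -/
theorem IsDoubleBracket.tripleBracket_of_quadraticTerm {e : ι → A}
    {br : A →ₗ[k] A →ₗ[k] A ⊗[k] A} (h : IsDoubleBracket e br) {a b c : A}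
    {p₁ q₁ s₁ t₁ p₂ q₂ s₂ t₂ p₃ q₃ s₃ t₃ : k}
    (h₁ : br a b = quadraticTerm p₁ q₁ s₁ t₁ a b)
    (h₂ : br b c = quadraticTerm p₂ q₂ s₂ t₂ b c)
    (h₃ : br c a = quadraticTerm p₃ q₃ s₃ t₃ c a)
    -- One equation for each monomial of `quasiPoissonTerm`. All other monomials in the cyclic sum
    -- cancel in pairs, whatever the coefficients.
    (e₁ : p₂ * s₁ + s₁ * q₃ - p₂ * q₃ = 1) (e₂ : p₁ * q₃ - t₂ * q₃ - p₁ * t₂ = -1)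
    (e₃ : p₂ * q₁ - p₂ * t₃ - t₃ * q₁ = -1) (e₄ : -(t₁ * t₂ + t₂ * t₃ + t₃ * t₁) = 1)
    (e₅ : s₁ * s₂ + s₂ * s₃ + s₃ * s₁ = -1) (e₆ : s₃ * q₂ - p₁ * q₂ + p₁ * s₃ = 1)
    (e₇ : s₂ * q₁ + p₃ * s₂ - p₃ * q₁ = 1) (e₈ : p₃ * q₂ - p₃ * t₁ - t₁ * q₂ = -1) :
    tripleBracket br a b c = (1 / 4 : k) • quasiPoissonTerm k a b c := by
  unfold tripleBracket
  rw [h.rTensor_quadraticTerm h₁ h₂ h₃, h.rTensor_quadraticTerm h₂ h₃ h₁,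
    h.rTensor_quadraticTerm h₃ h₁ h₂]
  simp only [map_smul, map_add, map_sub, cyc_tmul, ← smul_add]
  refine congrArg (fun z => (1 / 4 : k) • z) ?_
  have : quasiPoissonTerm k a b c =
    (p₂ * s₁ + s₁ * q₃ - p₂ * q₃) • ((c * a) ⊗ₜ[k] b ⊗ₜ[k] 1)
    + (p₁ * q₃ - t₂ * q₃ - p₁ * t₂) • ((c * a) ⊗ₜ[k] 1 ⊗ₜ[k] b)
    + (p₂ * q₁ - p₂ * t₃ - t₃ * q₁) • (c ⊗ₜ[k] (a * b) ⊗ₜ[k] 1)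
    + (-(t₁ * t₂ + t₂ * t₃ + t₃ * t₁)) • (c ⊗ₜ[k] a ⊗ₜ[k] b)
    + (s₁ * s₂ + s₂ * s₃ + s₃ * s₁) • (a ⊗ₜ[k] b ⊗ₜ[k] c)
    + (s₃ * q₂ - p₁ * q₂ + p₁ * s₃) • (a ⊗ₜ[k] 1 ⊗ₜ[k] (b * c))
    + (s₂ * q₁ + p₃ * s₂ - p₃ * q₁) • (1 ⊗ₜ[k] (a * b) ⊗ₜ[k] c)
    + (p₃ * q₂ - p₃ * t₁ - t₁ * q₂) • (1 ⊗ₜ[k] a ⊗ₜ[k] (b * c)) := by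
    rw [e₁, e₂, e₃, e₄, e₅, e₆, e₇, e₈]
    unfold quasiPoissonTerm
    module
  rw [this]
  module

end GeneralBrackets

/-! ### Twisted derivations and double brackets on group algebras -/

section FreeGroupAlgebras

open TensorProduct

variable {k : Type*} [Field k] {π : Type*} [Group π]

theorem FreeGroupBasis.closure_range {X : Type*} (b : FreeGroupBasis X π) :
    Subgroup.closure (Set.range b) = ⊤ := by
  have h := congrArg (Subgroup.map b.repr.symm.toMonoidHom) (FreeGroup.closure_range_of X)
  rw [MonoidHom.map_closure, Subgroup.map_top_of_surjective _ b.repr.symm.surjective,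
    ← Set.range_comp] at h
  exact h

/-- Linear maps `D` with `D (a b) = D a R(b) + L(a) D b` on a group algebra are determined by their
values on a generating set of the group. -/
theorem twistedDerivation_ext {B : Type*} [Ring B] [Algebra k B] (L R : MonoidAlgebra k π →* B)
    {D D' : MonoidAlgebra k π →ₗ[k] B} (hD : ∀ a b, D (a * b) = D a * R b + L a * D b)
    (hD' : ∀ a b, D' (a * b) = D' a * R b + L a * D' b) {S : Set π}
    (hS : Subgroup.closure S = ⊤)
    (h : ∀ g ∈ S, D (MonoidAlgebra.of k π g) = D' (MonoidAlgebra.of k π g)) : D = D' := by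
  have key : ∀ g : π, D (MonoidAlgebra.of k π g) = D' (MonoidAlgebra.of k π g) := by
    intro g
    have hone : D 1 = D' 1 := by
      have h₁ := hD 1 1
      have h₂ := hD' 1 1
      simp only [mul_one, map_one, one_mul, left_eq_add] at h₁ h₂
      rw [h₁, h₂]
    have hg : g ∈ Subgroup.closure S := hS ▸ Subgroup.mem_top g
    induction hg using Subgroup.closure_induction with
    | mem x hx => exact h x hx
    | one => rw [map_one, hone]
    | mul x y _ _ hx hy => rw [map_mul, hD, hD', hx, hy]
    | inv x _ hx =>
      have hinv : MonoidAlgebra.of k π x⁻¹ * MonoidAlgebra.of k π x = 1 := by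
        rw [← map_mul, inv_mul_cancel, map_one]
      have hinv' : MonoidAlgebra.of k π x * MonoidAlgebra.of k π x⁻¹ = 1 := by
        rw [← map_mul, mul_inv_cancel, map_one]
      -- Expand the common value at `x⁻¹ * x = 1`: the terms containing `D x = D' x` cancel, and
      -- right multiplication by `R x⁻¹` isolates the value at `x⁻¹`.
      have h₁ := hD (MonoidAlgebra.of k π x⁻¹) (MonoidAlgebra.of k π x)
      rw [hinv, hone, ← hinv, hD', hx] at h₁
      have h₂ := congrArg (· * R (MonoidAlgebra.of k π x⁻¹)) (add_right_cancel h₁)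
      simp only [mul_assoc, ← map_mul R, hinv', map_one, mul_one] at h₂
      exact h₂.symm
  refine (MonoidAlgebra.basis π k).ext fun g => ?_
  simpa using key g

/-- On the group algebra of a free group there are linear maps `D` with
`D (a b) = D a R(b) + L(a) D b` and with arbitrary values on the free generators. -/
theorem exists_twistedDerivation {B : Type*} [Ring B] [Algebra k B]
    (L R : MonoidAlgebra k π →ₐ[k] B) {X : Type*} (b : FreeGroupBasis X π) (v : X → B) :
    ∃ D : MonoidAlgebra k π →ₗ[k] B, (∀ a b, D (a * b) = D a * R b + L a * D b) ∧
      ∀ x, D (MonoidAlgebra.of k π (b x)) = v x := by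
  let o : π →* MonoidAlgebra k π := MonoidAlgebra.of k π
  have hL : ∀ g, L (o g) * L (o g⁻¹) = 1 := fun g => by
    rw [← map_mul, ← map_mul, mul_inv_cancel, map_one, map_one]
  have hL' : ∀ g, L (o g⁻¹) * L (o g) = 1 := fun g => by
    rw [← map_mul, ← map_mul, inv_mul_cancel, map_one, map_one]
  have hR : ∀ g, R (o g) * R (o g⁻¹) = 1 := fun g => by
    rw [← map_mul, ← map_mul, mul_inv_cancel, map_one, map_one]
  have hR' : ∀ g, R (o g⁻¹) * R (o g) = 1 := fun g => by
    rw [← map_mul, ← map_mul, inv_mul_cancel, map_one, map_one]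
  -- The rule `D (a b) = D a R(b) + L(a) D b` says exactly that the upper triangular matrix with
  -- rows `(L, D)` and `(0, R)` is multiplicative in `a`. Freeness gives a homomorphism to
  -- invertible matrices, and `D` is read off as its upper right entry.
  let u : X → (Matrix (Fin 2) (Fin 2) B)ˣ := fun x =>
    { val := !![L (o (b x)), v x; 0, R (o (b x))]
      inv := !![L (o (b x)⁻¹), -(L (o (b x)⁻¹) * v x * R (o (b x)⁻¹)); 0, R (o (b x)⁻¹)]
      val_inv := by
        rw [Matrix.mul_fin_two, hL, hR, mul_neg, ← mul_assoc, ← mul_assoc, hL]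
        simp [Matrix.one_fin_two]
      inv_val := by
        rw [Matrix.mul_fin_two, hL', hR', neg_mul _ (R (o (b x))), mul_assoc _ _ (R (o (b x))), hR']
        simp [Matrix.one_fin_two] }
  let F : MonoidAlgebra k π →ₐ[k] Matrix (Fin 2) (Fin 2) B :=
    MonoidAlgebra.lift k _ π ((Units.coeHom _).comp (b.lift u))
  have hF : ∀ g, F (o g) = (b.lift u g : Matrix (Fin 2) (Fin 2) B) := fun g =>
    MonoidAlgebra.lift_of _ g
  have hFx : ∀ x, F (o (b x)) = !![L (o (b x)), v x; 0, R (o (b x))] := fun x => by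
    rw [hF]
    simp [u]
  have hFx' : ∀ x, F (o (b x)⁻¹) =
      !![L (o (b x)⁻¹), -(L (o (b x)⁻¹) * v x * R (o (b x)⁻¹)); 0, R (o (b x)⁻¹)] := fun x => by
    rw [hF, map_inv]
    simp [u]
  -- The claim is carried for `g` and `g⁻¹` together, so that the inverse case of the closure
  -- induction is a swap.
  have hgroup : ∀ g, (F (o g) 0 0 = L (o g) ∧ F (o g) 1 0 = 0 ∧ F (o g) 1 1 = R (o g)) ∧
      (F (o g⁻¹) 0 0 = L (o g⁻¹) ∧ F (o g⁻¹) 1 0 = 0 ∧ F (o g⁻¹) 1 1 = R (o g⁻¹)) := by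
    intro g
    have hg : g ∈ Subgroup.closure (Set.range b) := b.closure_range ▸ Subgroup.mem_top g
    induction hg using Subgroup.closure_induction with
    | mem x hx => obtain ⟨x, rfl⟩ := hx; rw [hFx, hFx']; simp
    | one => rw [inv_one, map_one, map_one, map_one, map_one]; simp
    | mul x y _ _ hx hy =>
      simp only [mul_inv_rev, map_mul, Matrix.mul_apply, Fin.sum_univ_two, hx, hy, mul_zero,
        zero_mul, add_zero, zero_add, and_self]
    | inv x _ hx => exact ⟨hx.2, by rw [inv_inv]; exact hx.1⟩
  have hlin : ∀ a, F a 0 0 = L a ∧ F a 1 0 = 0 ∧ F a 1 1 = R a := by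
    intro a
    induction a using MonoidAlgebra.induction_on with
    | of g => exact (hgroup g).1
    | add a b ha hb => simp [ha, hb]
    | smul c a ha => simp [ha]
  refine ⟨(Matrix.entryLinearMap k B 0 1) ∘ₗ F.toLinearMap, fun a c => ?_, fun x => ?_⟩
  · simp [Matrix.mul_apply, hlin, add_comm]
  · have := hFx x
    simp [o] at this
    simp [this]

/-- A free group algebra has a double bracket with arbitrary antisymmetric values on the free
generators. -/
theorem exists_isDoubleBracket {X : Type*} (b : FreeGroupBasis X π)
    (v : X → X → MonoidAlgebra k π ⊗[k] MonoidAlgebra k π)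
    (hv : ∀ x y, v x y = -TensorProduct.comm k _ _ (v y x)) :
    ∃ br : MonoidAlgebra k π →ₗ[k] MonoidAlgebra k π →ₗ[k]
        MonoidAlgebra k π ⊗[k] MonoidAlgebra k π,
      IsDoubleBracket (fun _ : Unit => (1 : MonoidAlgebra k π)) br ∧
      ∀ x y, br (MonoidAlgebra.of k π (b x)) (MonoidAlgebra.of k π (b y)) = v x y := by
  let o : π →* MonoidAlgebra k π := MonoidAlgebra.of k π
  let incl : MonoidAlgebra k π →ₐ[k] MonoidAlgebra k π ⊗[k] MonoidAlgebra k π :=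
    Algebra.TensorProduct.includeLeft
  let incr : MonoidAlgebra k π →ₐ[k] MonoidAlgebra k π ⊗[k] MonoidAlgebra k π :=
    Algebra.TensorProduct.includeRight
  have commute : ∀ a c, incl a * incr c = incr c * incl a := fun a c => by
    simp [incl, incr]
  -- Two extensions: `E y` extends `v · y` as an inner derivation in the first argument; `D g` then
  -- extends `y ↦ E y g` as an outer derivation in the second.
  choose E hE hEx using fun y => exists_twistedDerivation incr incl b (fun x => v x y)
  choose D hD hDy using fun g : π => exists_twistedDerivation incl incr b (fun y => E y (o g))
  let br := (MonoidAlgebra.basis π k).constr k D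
  have hbr : ∀ g, br (o g) = D g := fun g => by
    have := (MonoidAlgebra.basis π k).constr_basis k D g
    simpa [br, o] using this
  have leib : ∀ a c d, br a (c * d) = br a c * incr d + incl c * br a d := by
    intro a c d
    induction a using MonoidAlgebra.induction_on with
    | of g => rw [hbr, hD]
    | add a a' h h' => simp only [map_add, LinearMap.add_apply, h, h', add_mul, mul_add]; abel
    | smul t a h =>
      simp only [map_smul, LinearMap.smul_apply, h, smul_mul_assoc, mul_smul_comm, smul_add]
  have hbrE : ∀ a y, br a (o (b y)) = E y a := by
    intro a y
    induction a using MonoidAlgebra.induction_on with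
    | of g => rw [hbr, hDy]
    | add a a' h h' => simp only [map_add, LinearMap.add_apply, h, h']
    | smul t a h => simp only [map_smul, LinearMap.smul_apply, h]
  have leib' : ∀ a c d, br (a * c) d = br a d * incl c + incr a * br c d := by
    intro a c d
    -- Because the inner and outer actions commute, both sides are outer derivations in `d`, so it
    -- suffices to take `d` a free generator, where the rule is the one for `E y`.
    have : br (a * c) = LinearMap.mulRight k (incl c) ∘ₗ br a
        + LinearMap.mulLeft k (incr a) ∘ₗ br c := by
      refine twistedDerivation_ext (incl : _ →* _) (incr : _ →* _) (leib (a * c)) ?_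
        b.closure_range ?_
      · intro x y
        simp only [LinearMap.add_apply, LinearMap.comp_apply, LinearMap.mulRight_apply,
          LinearMap.mulLeft_apply, leib, mul_add, add_mul, MonoidHom.coe_coe]
        rw [mul_assoc _ (incr y), ← commute, mul_assoc _ _ (incr y), ← mul_assoc (incr a) (incl x),
          ← commute]
        simp only [mul_assoc]
        abel
      · rintro _ ⟨y, rfl⟩
        simp only [LinearMap.add_apply, LinearMap.comp_apply, LinearMap.mulRight_apply,
          LinearMap.mulLeft_apply]
        exact (hbrE _ y).trans ((hE y a c).trans (by rw [← hbrE, ← hbrE]))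
    rw [this]
    rfl
  -- Antisymmetry is first extended in one argument with the other a generator, then in the second
  -- argument.
  have antisymm_gen : ∀ a y, br a (o (b y)) = negComm k _ (br (o (b y)) a) := by
    intro a y
    have : br.flip (o (b y)) = negComm k _ ∘ₗ br (o (b y)) := by
      refine twistedDerivation_ext (incr : _ →* _) (incl : _ →* _) (fun c d => leib' c d _) ?_
        b.closure_range ?_
      · intro c d
        rw [LinearMap.comp_apply, leib, map_add]
        exact congrArg₂ (· + ·) (negComm_mul_one_tmul _ d) (negComm_tmul_one_mul _ c)
      · rintro _ ⟨x, rfl⟩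
        rw [LinearMap.flip_apply, LinearMap.comp_apply, negComm_apply]
        exact (hbrE _ y).trans ((hEx y x).trans ((hv x y).trans
          (by rw [← hEx x y, ← hbrE])))
    exact LinearMap.congr_fun this a
  have antisymm : ∀ a c, br a c = negComm k _ (br c a) := by
    intro a c
    have : br a = negComm k _ ∘ₗ br.flip a := by
      refine twistedDerivation_ext (incl : _ →* _) (incr : _ →* _) (leib a) ?_
        b.closure_range ?_
      · intro c d
        rw [LinearMap.comp_apply, LinearMap.flip_apply, leib', map_add]
        exact congrArg₂ (· + ·) (negComm_mul_tmul_one _ d) (negComm_one_tmul_mul _ c)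
      · rintro _ ⟨y, rfl⟩
        exact antisymm_gen a y
    exact LinearMap.congr_fun this c
  have hone : ∀ a, br a 1 = 0 := fun a => by
    have := leib a 1 1
    simpa using this
  exact ⟨br, ⟨fun _ a => by rw [antisymm, hone, map_zero], fun _ a => hone a, antisymm, leib⟩,
    fun x y => (hbrE _ y).trans (hEx y x)⟩

/-- A double bracket on a group algebra is determined by its values on generators. -/
theorem IsDoubleBracket.ext_of_closure {ι : Type*} {e : ι → MonoidAlgebra k π}
    {br br' : MonoidAlgebra k π →ₗ[k] MonoidAlgebra k π →ₗ[k]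
      MonoidAlgebra k π ⊗[k] MonoidAlgebra k π}
    (h : IsDoubleBracket e br) (h' : IsDoubleBracket e br') {S : Set π}
    (hS : Subgroup.closure S = ⊤)
    (hv : ∀ x ∈ S, ∀ y ∈ S, br (MonoidAlgebra.of k π x) (MonoidAlgebra.of k π y) =
      br' (MonoidAlgebra.of k π x) (MonoidAlgebra.of k π y)) : br = br' := by
  -- The second argument is freed by the outer rule with the first a generator; the flipped bracket
  -- then frees the first by the inner rule.
  have hx : ∀ x ∈ S, br (MonoidAlgebra.of k π x) = br' (MonoidAlgebra.of k π x) := fun x hx =>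
    twistedDerivation_ext
      (Algebra.TensorProduct.includeLeft : MonoidAlgebra k π →ₐ[k] _ ⊗[k] MonoidAlgebra k π)
      (Algebra.TensorProduct.includeRight : MonoidAlgebra k π →ₐ[k] MonoidAlgebra k π ⊗[k] _)
      (h.leibniz _) (h'.leibniz _) hS (hv x hx)
  have hflip : ∀ a, br.flip a = br'.flip a := fun a =>
    twistedDerivation_ext
      (Algebra.TensorProduct.includeRight : MonoidAlgebra k π →ₐ[k] MonoidAlgebra k π ⊗[k] _)
      (Algebra.TensorProduct.includeLeft : MonoidAlgebra k π →ₐ[k] _ ⊗[k] MonoidAlgebra k π)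
      (fun c d => (h.leibniz_left c d a).trans (add_comm _ _))
      (fun c d => (h'.leibniz_left c d a).trans (add_comm _ _)) hS
      fun x hx' => LinearMap.congr_fun (hx x hx') a
  exact LinearMap.ext fun a => LinearMap.ext fun c => LinearMap.congr_fun (hflip c) a

/-- The triple bracket as a linear map in its last argument. -/
noncomputable def tripleBracketLinear {A : Type*} [Ring A] [Algebra k A]
    (br : A →ₗ[k] A →ₗ[k] A ⊗[k] A) (a b : A) : A →ₗ[k] (A ⊗[k] A) ⊗[k] A :=
  IsLinearMap.mk' (tripleBracket br a b)
    { map_add := fun c d => by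
        unfold tripleBracket
        simp only [map_add, LinearMap.add_apply, LinearMap.rTensor_add]
        abel
      map_smul := fun t c => by
        unfold tripleBracket
        simp only [map_smul, LinearMap.smul_apply, LinearMap.rTensor_smul, smul_add] }

/-- The right hand side of the quasi-Poisson identity as a linear map in its last argument. -/
noncomputable def quasiPoissonTermLinear {A : Type*} [Ring A] [Algebra k A] (a b : A) :
    A →ₗ[k] (A ⊗[k] A) ⊗[k] A :=
  IsLinearMap.mk' (fun c => (1 / 4 : k) • quasiPoissonTerm k a b c)
    { map_add := fun c d => by
        unfold quasiPoissonTerm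
        simp only [add_mul, mul_add, add_tmul, tmul_add]
        module
      map_smul := fun t c => by
        unfold quasiPoissonTerm
        simp only [smul_mul_assoc, mul_smul_comm, ← smul_tmul', tmul_smul]
        module }

/-- The quasi-Poisson identity on a group algebra follows from the case of generators. -/
theorem IsDoubleBracket.quasiPoisson_of_closure {ι : Type*} {e : ι → MonoidAlgebra k π}
    {br : MonoidAlgebra k π →ₗ[k] MonoidAlgebra k π →ₗ[k]
      MonoidAlgebra k π ⊗[k] MonoidAlgebra k π}
    (h : IsDoubleBracket e br) {S : Set π} (hS : Subgroup.closure S = ⊤)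
    (hq : ∀ x ∈ S, ∀ y ∈ S, ∀ z ∈ S,
      tripleBracket br (MonoidAlgebra.of k π x) (MonoidAlgebra.of k π y) (MonoidAlgebra.of k π z) =
        (1 / 4 : k) • quasiPoissonTerm k (MonoidAlgebra.of k π x) (MonoidAlgebra.of k π y)
          (MonoidAlgebra.of k π z)) (a b c : MonoidAlgebra k π) :
    tripleBracket br a b c = (1 / 4 : k) • quasiPoissonTerm k a b c := by
  have extend : ∀ a b, (∀ z ∈ S, tripleBracket br a b (MonoidAlgebra.of k π z) =
      (1 / 4 : k) • quasiPoissonTerm k a b (MonoidAlgebra.of k π z)) →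
      ∀ c, tripleBracket br a b c = (1 / 4 : k) • quasiPoissonTerm k a b c := by
    intro a b hab c
    have : tripleBracketLinear br a b = quasiPoissonTermLinear a b := by
      refine twistedDerivation_ext (tripleLeft k (MonoidAlgebra k π))
        (tripleRight k (MonoidAlgebra k π))
        (fun c d => h.tripleBracket_leibniz a b c d) (fun c d => ?_) hS hab
      change (1 / 4 : k) • quasiPoissonTerm k a b (c * d) =
        ((1 / 4 : k) • quasiPoissonTerm k a b c) * (1 ⊗ₜ[k] 1 ⊗ₜ[k] d)
          + (c ⊗ₜ[k] 1 ⊗ₜ[k] 1) * ((1 / 4 : k) • quasiPoissonTerm k a b d)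
      rw [quasiPoissonTerm_leibniz, smul_add, smul_mul_assoc, mul_smul_comm]
    exact LinearMap.congr_fun this c
  have rotate : ∀ a b c, tripleBracket br b c a = (1 / 4 : k) • quasiPoissonTerm k b c a →
      tripleBracket br a b c = (1 / 4 : k) • quasiPoissonTerm k a b c := by
    intro a b c habc
    rw [← cyc_tripleBracket, habc, map_smul, cyc_quasiPoissonTerm]
  -- `extend` frees the last slot and `rotate` moves a remaining generator into it; three rounds
  -- free all slots.
  refine extend _ _ (fun z hz => rotate _ _ _ (extend _ _ (fun y hy => rotate _ _ _
    (extend _ _ (fun x hx => hq z hz y hy x hx) b)) a)) c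

/-- `½ (a ⊗ u - 1 ⊗ u a + a u ⊗ 1 - u ⊗ a)`. -/
noncomputable def momentTerm (k : Type*) {A : Type*} [Field k] [Ring A] [Algebra k A] (u a : A) :
    A ⊗[k] A :=
  (1 / 2 : k) • (a ⊗ₜ[k] u - 1 ⊗ₜ[k] (u * a) + (a * u) ⊗ₜ[k] 1 - u ⊗ₜ[k] a)

theorem momentTerm_leibniz {A : Type*} [Ring A] [Algebra k A] (u a b : A) :
    momentTerm k u (a * b) =
      momentTerm k u a * (1 ⊗ₜ[k] b) + (a ⊗ₜ[k] 1) * momentTerm k u b := by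
  unfold momentTerm
  simp only [smul_mul_assoc, mul_smul_comm, mul_add, add_mul, mul_sub, sub_mul,
    Algebra.TensorProduct.tmul_mul_tmul, mul_one, one_mul, mul_assoc]
  module

/-- The moment map equation on a group algebra follows from the case of generators. -/
theorem IsDoubleBracket.moment_of_closure {ι : Type*} {e : ι → MonoidAlgebra k π}
    {br : MonoidAlgebra k π →ₗ[k] MonoidAlgebra k π →ₗ[k]
      MonoidAlgebra k π ⊗[k] MonoidAlgebra k π}
    (h : IsDoubleBracket e br) {S : Set π} (hS : Subgroup.closure S = ⊤) (u : MonoidAlgebra k π)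
    (hu : ∀ x ∈ S, br u (MonoidAlgebra.of k π x) = momentTerm k u (MonoidAlgebra.of k π x))
    (a : MonoidAlgebra k π) : br u a = momentTerm k u a := by
  let D : MonoidAlgebra k π →ₗ[k] MonoidAlgebra k π ⊗[k] MonoidAlgebra k π :=
    IsLinearMap.mk' (momentTerm k u)
    { map_add := fun c d => by
        unfold momentTerm
        simp only [add_mul, mul_add, add_tmul, tmul_add]
        module
      map_smul := fun t c => by
        unfold momentTerm
        simp only [smul_mul_assoc, mul_smul_comm, ← smul_tmul', tmul_smul]
        module }
  have : br u = D := twistedDerivation_ext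
    (MonoidHomClass.toMonoidHom
      (Algebra.TensorProduct.includeLeft : MonoidAlgebra k π →ₐ[k] _ ⊗[k] MonoidAlgebra k π))
    (MonoidHomClass.toMonoidHom
      (Algebra.TensorProduct.includeRight : MonoidAlgebra k π →ₐ[k] MonoidAlgebra k π ⊗[k] _))
    (h.leibniz u) (momentTerm_leibniz u) hS hu
  exact LinearMap.congr_fun this a

end FreeGroupAlgebras

/-! ### Ordered free generators and their prescribed brackets -/

section SurfaceBrackets

open TensorProduct

/-- The free generators `αᵢ, βᵢ, γₗ` of a surface group. -/
inductive SurfaceFreeGen (g r : ℕ) : Type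
  | alpha (i : Fin g)
  | beta (i : Fin g)
  | gamma (l : Fin r)

namespace SurfaceFreeGen

variable {g r : ℕ}

/-- The position of a free generator in the order `α₁, β₁, …, α_g, β_g, γ₁, …, γ_r`. -/
def pos : SurfaceFreeGen g r → ℕ
  | alpha i => 2 * i
  | beta i => 2 * i + 1
  | gamma l => 2 * g + l

theorem pos_injective : Function.Injective (pos : SurfaceFreeGen g r → ℕ) := by
  intro x y h
  cases x <;> cases y <;> simp only [pos] at h <;>
    first
    | (congr 1; ext; omega)
    | omega

/-- The sign in the self-bracket of a free generator. -/
def selfSign (k : Type*) [Field k] : SurfaceFreeGen g r → k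
  | beta _ => -1
  | _ => 1

/-- The sign of the difference of positions. -/
def orderSign (k : Type*) [Field k] (x y : SurfaceFreeGen g r) : k :=
  if pos x < pos y then 1 else if pos y < pos x then -1 else 0

/-- The coefficient of `y ⊗ x` in twice the bracket of `x` and `y`. -/
def swapCoeff (k : Type*) [Field k] : SurfaceFreeGen g r → SurfaceFreeGen g r → k
  | alpha i, beta j => if i = j then 1 else -orderSign k (alpha i : SurfaceFreeGen g r) (beta j)
  | beta i, alpha j => if i = j then -1 else -orderSign k (beta i : SurfaceFreeGen g r) (alpha j)
  | x, y => -orderSign k x y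

variable {k : Type*} [Field k] {A : Type*} [Ring A] [Algebra k A]

theorem orderSign_of_lt {x y : SurfaceFreeGen g r} (h : pos x < pos y) : orderSign k x y = 1 := by
  simp [orderSign, h]

theorem orderSign_of_gt {x y : SurfaceFreeGen g r} (h : pos y < pos x) :
    orderSign k x y = -1 := by
  simp [orderSign, h, h.le.not_gt]

theorem orderSign_self (x : SurfaceFreeGen g r) : orderSign k x x = 0 := by
  simp [orderSign]

theorem orderSign_swap (x y : SurfaceFreeGen g r) : orderSign k y x = -orderSign k x y := by
  rcases lt_trichotomy (pos x) (pos y) with h | h | h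
  · rw [orderSign_of_lt h, orderSign_of_gt h]
  · rw [pos_injective h, orderSign_self, neg_zero]
  · rw [orderSign_of_lt h, orderSign_of_gt h, neg_neg]

theorem swapCoeff_swap (x y : SurfaceFreeGen g r) : swapCoeff k y x = -swapCoeff k x y := by
  cases x <;> cases y <;> simp only [swapCoeff]
  case alpha.beta i j =>
    by_cases h : i = j
    · simp [h]
    · rw [if_neg h, if_neg (Ne.symm h), orderSign_swap]
  case beta.alpha i j =>
    by_cases h : i = j
    · simp [h]
    · rw [if_neg h, if_neg (Ne.symm h), orderSign_swap]
  all_goals rw [orderSign_swap]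

/-- For `αᵢ` and `βᵢ` the number `pos / 2` is the handle index, so distinct values exclude the
irregular pair. Two neighbouring `γ`'s may share this value; they need `swapCoeff_gamma_gamma`. -/
theorem swapCoeff_of_div_ne {x y : SurfaceFreeGen g r} (h : pos x / 2 ≠ pos y / 2) :
    swapCoeff k x y = -orderSign k x y := by
  cases x <;> cases y <;> simp only [swapCoeff]
  all_goals
    rw [if_neg]
    rintro rfl
    simp only [pos] at h
    omega

/-- The equality of halves says that an irregular pair is adjacent, so no third generator lies
between its members. The sign equations of `tripleBracket_eq` depend on this. -/
theorem swapCoeff_of_lt {x y : SurfaceFreeGen g r} (h : pos x < pos y) :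
    swapCoeff k x y = -1 ∨ (swapCoeff k x y = 1 ∧ pos x / 2 = pos y / 2) := by
  cases x <;> cases y <;> simp only [swapCoeff, orderSign_of_lt h, true_or]
  case alpha.beta i j =>
    split_ifs with hij
    · subst hij
      right
      simp only [pos]
      exact ⟨trivial, by omega⟩
    · simp
  case beta.alpha i j =>
    split_ifs <;> simp

theorem swapCoeff_of_gt {x y : SurfaceFreeGen g r} (h : pos y < pos x) :
    swapCoeff k x y = 1 ∨ (swapCoeff k x y = -1 ∧ pos x / 2 = pos y / 2) := by
  rw [swapCoeff_swap y x]
  rcases swapCoeff_of_lt (k := k) h with h' | ⟨h', h''⟩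
  · exact Or.inl (by rw [h', neg_neg])
  · exact Or.inr ⟨by rw [h'], h''.symm⟩

theorem swapCoeff_gamma_gamma (l m : Fin r) : swapCoeff k (gamma l : SurfaceFreeGen g r) (gamma m) =
    -orderSign k (gamma l : SurfaceFreeGen g r) (gamma m) := rfl

theorem selfSign_eq (x : SurfaceFreeGen g r) : selfSign k x = 1 ∨ selfSign k x = -1 := by
  cases x <;> simp [selfSign]

/-- Either the pair is regular or it is `αᵢ, βᵢ` in some order, where all signs agree with the
self-sign of `x`. This is the dichotomy needed for triples with a repetition. -/
theorem swapCoeff_eq (x y : SurfaceFreeGen g r) : swapCoeff k x y = -orderSign k x y ∨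
    (swapCoeff k x y = selfSign k x ∧ orderSign k x y = selfSign k x) := by
  cases x <;> cases y <;> simp only [swapCoeff, true_or]
  case alpha.beta i j =>
    split_ifs with hij
    · exact Or.inr ⟨rfl, orderSign_of_lt (by simp only [pos]; omega)⟩
    · exact Or.inl rfl
  case beta.alpha i j =>
    split_ifs with hij
    · exact Or.inr ⟨rfl, orderSign_of_gt (by simp only [pos]; omega)⟩
    · exact Or.inl rfl

/-- The prescribed bracket of the free generators `x` and `y`, represented by elements `a x`
and `a y`. -/
noncomputable def bracketValue (k : Type*) [Field k] {A : Type*} [Ring A] [Algebra k A]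
    (a : SurfaceFreeGen g r → A) (x y : SurfaceFreeGen g r) : A ⊗[k] A :=
  if pos x = pos y then quadraticTerm (selfSign k x) (-selfSign k x) 0 0 (a x) (a y)
  else quadraticTerm (orderSign k x y) (orderSign k x y) (-orderSign k x y) (swapCoeff k x y)
    (a x) (a y)

theorem bracketValue_self (a : SurfaceFreeGen g r → A) (x : SurfaceFreeGen g r) :
    bracketValue k a x x = quadraticTerm (selfSign k x) (-selfSign k x) 0 0 (a x) (a x) :=
  if_pos rfl

theorem bracketValue_of_ne (a : SurfaceFreeGen g r → A) {x y : SurfaceFreeGen g r}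
    (h : pos x ≠ pos y) : bracketValue k a x y = quadraticTerm (orderSign k x y)
      (orderSign k x y) (-orderSign k x y) (swapCoeff k x y) (a x) (a y) :=
  if_neg h

theorem bracketValue_antisymm (a : SurfaceFreeGen g r → A) (x y : SurfaceFreeGen g r) :
    bracketValue k a x y = -TensorProduct.comm k A A (bracketValue k a y x) := by
  by_cases h : pos x = pos y
  · rw [pos_injective h, bracketValue_self, comm_quadraticTerm, neg_quadraticTerm]
    simp
  · rw [bracketValue_of_ne a h, bracketValue_of_ne a (Ne.symm h), comm_quadraticTerm,
      neg_quadraticTerm, orderSign_swap y x, swapCoeff_swap y x]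

theorem quadraticTerm_fusion (x y : A) :
    quadraticTerm (1 : k) 1 (-1) (-1) x y = fusionTerm k x y := by
  unfold quadraticTerm fusionTerm
  module

theorem bracketValue_of_lt (a : SurfaceFreeGen g r → A) {x y : SurfaceFreeGen g r}
    (h : pos x < pos y) (h' : pos x / 2 ≠ pos y / 2) :
    bracketValue k a x y = fusionTerm k (a x) (a y) := by
  rw [bracketValue_of_ne a h.ne, swapCoeff_of_div_ne h', orderSign_of_lt h, quadraticTerm_fusion]

theorem bracketValue_of_gt (a : SurfaceFreeGen g r → A) {x y : SurfaceFreeGen g r}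
    (h : pos y < pos x) (h' : pos x / 2 ≠ pos y / 2) :
    bracketValue k a x y = (-1 : k) • fusionTerm k (a x) (a y) := by
  rw [bracketValue_of_ne a h.ne', swapCoeff_of_div_ne h', orderSign_of_gt h,
    ← quadraticTerm_fusion]
  unfold quadraticTerm
  module

theorem bracketValue_gamma_gamma (a : SurfaceFreeGen g r → A) {l m : Fin r} (h : l < m) :
    bracketValue k a (gamma l) (gamma m) = fusionTerm k (a (gamma l)) (a (gamma m)) := by
  have h : pos (gamma l : SurfaceFreeGen g r) < pos (gamma m : SurfaceFreeGen g r) := by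
    simp only [pos]; omega
  rw [bracketValue_of_ne a h.ne, swapCoeff_gamma_gamma, orderSign_of_lt h,
    quadraticTerm_fusion]

theorem bracketValue_gamma_gamma' (a : SurfaceFreeGen g r → A) {l m : Fin r} (h : l < m) :
    bracketValue k a (gamma m) (gamma l) = (-1 : k) • fusionTerm k (a (gamma m)) (a (gamma l)) := by
  have h : pos (gamma l : SurfaceFreeGen g r) < pos (gamma m : SurfaceFreeGen g r) := by
    simp only [pos]; omega
  rw [bracketValue_of_ne a h.ne', swapCoeff_gamma_gamma, orderSign_of_gt h,
    ← quadraticTerm_fusion]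
  unfold quadraticTerm
  module

theorem bracketValue_alpha_beta (a : SurfaceFreeGen g r → A) (i : Fin g) :
    bracketValue k a (alpha i) (beta i) =
      quadraticTerm 1 1 (-1) 1 (a (alpha i)) (a (beta i)) := by
  have h : pos (alpha i : SurfaceFreeGen g r) < pos (beta i : SurfaceFreeGen g r) := by
    simp [pos]
  rw [bracketValue_of_ne a h.ne, swapCoeff, if_pos rfl, orderSign_of_lt h]

/-- The prescribed values cover the diagonal and pairs in increasing order; antisymmetry forces the
rest. -/
theorem bracketValue_eq_of_hasMassuyeauTuraevValues {ι : Type*} {e : ι → A}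
    {br : A →ₗ[k] A →ₗ[k] A ⊗[k] A} (h : IsDoubleBracket e br) (a : SurfaceFreeGen g r → A)
    (hv : HasMassuyeauTuraevValues (fun i => a (alpha i)) (fun i => a (beta i))
      (fun l => a (gamma l)) br) (x y : SurfaceFreeGen g r) :
    br (a x) (a y) = bracketValue k a x y := by
  have lt_case : ∀ x y, pos x < pos y → br (a x) (a y) = bracketValue k a x y := by
    intro x y hxy
    by_cases h' : pos x / 2 = pos y / 2
    -- Equal halves leave only `αᵢ, βᵢ` and two neighbouring `γ`'s.
    · cases x <;> cases y <;> simp only [pos] at hxy h' <;> try omega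
      case alpha.beta i j =>
        obtain rfl : i = j := by ext; omega
        rw [bracketValue_alpha_beta, hv.alpha_beta]
        unfold quadraticTerm
        module
      case gamma.gamma l m =>
        have hlm : l < m := by rw [Fin.lt_def]; omega
        rw [bracketValue_gamma_gamma a hlm, hv.gamma_gamma' l m hlm]
    · rw [bracketValue_of_lt a hxy h']
      cases x <;> cases y <;> simp only [pos] at hxy h'
      case alpha.alpha i j =>
        exact hv.handle_handle i j (by rw [Fin.lt_def]; omega) _ (by simp) _ (by simp)
      case alpha.beta i j =>
        exact hv.handle_handle i j (by rw [Fin.lt_def]; omega) _ (by simp) _ (by simp)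
      case beta.alpha i j =>
        exact hv.handle_handle i j (by rw [Fin.lt_def]; omega) _ (by simp) _ (by simp)
      case beta.beta i j =>
        exact hv.handle_handle i j (by rw [Fin.lt_def]; omega) _ (by simp) _ (by simp)
      case alpha.gamma i l => exact hv.handle_gamma i l _ (by simp)
      case beta.gamma i l => exact hv.handle_gamma i l _ (by simp)
      case gamma.gamma l m => exact hv.gamma_gamma' l m (by rw [Fin.lt_def]; omega)
      all_goals omega
  rcases lt_trichotomy (pos x) (pos y) with hxy | hxy | hxy
  · exact lt_case x y hxy
  · rw [← pos_injective hxy, bracketValue_self]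
    cases x
    · rw [hv.alpha_alpha]; unfold quadraticTerm selfSign; simp only [pow_two]; module
    · rw [hv.beta_beta]; unfold quadraticTerm selfSign; simp only [pow_two]; module
    · rw [hv.gamma_gamma]; unfold quadraticTerm selfSign; simp only [pow_two]; module
  · rw [h.antisymm, lt_case y x hxy, ← bracketValue_antisymm]

theorem hasMassuyeauTuraevValues_of_bracketValue {br : A →ₗ[k] A →ₗ[k] A ⊗[k] A}
    (a : SurfaceFreeGen g r → A) (hv : ∀ x y, br (a x) (a y) = bracketValue k a x y) :
    HasMassuyeauTuraevValues (fun i => a (alpha i)) (fun i => a (beta i))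
      (fun l => a (gamma l)) br where
  alpha_alpha i := by
    rw [hv, bracketValue_self]; unfold quadraticTerm selfSign; simp only [pow_two]; module
  beta_beta i := by
    rw [hv, bracketValue_self]; unfold quadraticTerm selfSign; simp only [pow_two]; module
  alpha_beta i := by
    rw [hv, bracketValue_alpha_beta]; unfold quadraticTerm; module
  handle_handle i j hij x hx y hy := by
    rw [Fin.lt_def] at hij
    simp only [Set.mem_insert_iff, Set.mem_singleton_iff] at hx hy
    rcases hx with rfl | rfl <;> rcases hy with rfl | rfl <;>
      exact (hv _ _).trans
        (bracketValue_of_lt a (by simp only [pos]; omega) (by simp only [pos]; omega))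
  handle_gamma i l x hx := by
    simp only [Set.mem_insert_iff, Set.mem_singleton_iff] at hx
    rcases hx with rfl | rfl <;>
      exact (hv _ _).trans
        (bracketValue_of_lt a (by simp only [pos]; omega) (by simp only [pos]; omega))
  gamma_gamma l := by
    rw [hv, bracketValue_self]; unfold quadraticTerm selfSign; simp only [pow_two]; module
  gamma_gamma' l m hlm := by rw [hv, bracketValue_gamma_gamma a hlm]

/-- On the diagonal the mixed monomials coincide, so their coefficients matter only through their
sum, and `s` is free. -/
theorem quadraticTerm_self (s : k) (p q : k) (x : A) :
    quadraticTerm p q 0 0 x x = quadraticTerm p q s (-s) x x := by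
  unfold quadraticTerm
  module

/-- The quasi-Poisson identity for free generators, two of which agree. -/
theorem tripleBracket_self {ι : Type*} {e : ι → A}
    {br : A →ₗ[k] A →ₗ[k] A ⊗[k] A} (h : IsDoubleBracket e br) (a : SurfaceFreeGen g r → A)
    (hv : ∀ x y, br (a x) (a y) = bracketValue k a x y) (x z : SurfaceFreeGen g r) :
    tripleBracket br (a x) (a x) (a z) =
      (1 / 4 : k) • quasiPoissonTerm k (a x) (a x) (a z) := by
  have hxx := (hv x x).trans (bracketValue_self a x)
  by_cases hxz : pos x = pos z
  · rw [← pos_injective hxz]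
    rcases selfSign_eq (k := k) x with hs | hs <;> rw [hs] at hxx <;>
    -- With all mixed coefficients zero, `e₄` and `e₅` would fail; representing the same bracket
    -- with `s = 1`, `-1` and `0` satisfies all eight equations.
    refine h.tripleBracket_of_quadraticTerm (hxx.trans (quadraticTerm_self 1 _ _ _))
      (hxx.trans (quadraticTerm_self (-1) _ _ _)) hxx ?_ ?_ ?_ ?_ ?_ ?_ ?_ ?_ <;> ring
  · have hxz' := (hv x z).trans (bracketValue_of_ne a hxz)
    have hzx' := (hv z x).trans (bracketValue_of_ne a (Ne.symm hxz))
    rw [orderSign_swap x z, swapCoeff_swap x z] at hzx'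
    rcases swapCoeff_eq (k := k) x z with ht | ⟨ht, hε⟩
    · have hε : orderSign k x z = 1 ∨ orderSign k x z = -1 := by
        rcases lt_or_gt_of_ne hxz with h | h
        · exact Or.inl (orderSign_of_lt h)
        · exact Or.inr (orderSign_of_gt h)
      rcases selfSign_eq (k := k) x with hs | hs <;> rcases hε with hε | hε <;>
        rw [ht, hε] at hxz' hzx' <;> rw [hs] at hxx <;>
        refine h.tripleBracket_of_quadraticTerm hxx hxz' hzx' ?_ ?_ ?_ ?_ ?_ ?_ ?_ ?_ <;> ring
    · rcases selfSign_eq (k := k) x with hs | hs <;>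
        rw [ht, hε, hs] at hxz' hzx' <;> rw [hs] at hxx <;>
        refine h.tripleBracket_of_quadraticTerm hxx hxz' hzx' ?_ ?_ ?_ ?_ ?_ ?_ ?_ ?_ <;> ring

/-- The quasi-Poisson identity for the free generators. -/
theorem tripleBracket_eq {ι : Type*} {e : ι → A}
    {br : A →ₗ[k] A →ₗ[k] A ⊗[k] A} (h : IsDoubleBracket e br) (a : SurfaceFreeGen g r → A)
    (hv : ∀ x y, br (a x) (a y) = bracketValue k a x y) (x y z : SurfaceFreeGen g r) :
    tripleBracket br (a x) (a y) (a z) =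
      (1 / 4 : k) • quasiPoissonTerm k (a x) (a y) (a z) := by
  by_cases hxy : pos x = pos y
  · rw [← pos_injective hxy]
    exact tripleBracket_self h a hv x z
  by_cases hyz : pos y = pos z
  · rw [← pos_injective hyz, ← cyc_tripleBracket, tripleBracket_self h a hv, map_smul,
      cyc_quasiPoissonTerm]
  by_cases hzx : pos z = pos x
  · rw [pos_injective hzx, ← cyc_tripleBracket, ← cyc_tripleBracket, tripleBracket_self h a hv,
      map_smul, map_smul, cyc_quasiPoissonTerm, cyc_quasiPoissonTerm]
  have signs : ∀ x y : SurfaceFreeGen g r, pos x ≠ pos y →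
      (pos x < pos y ∧ orderSign k x y = 1 ∧
        (swapCoeff k x y = -1 ∨ (swapCoeff k x y = 1 ∧ pos x / 2 = pos y / 2))) ∨
      (pos y < pos x ∧ orderSign k x y = -1 ∧
        (swapCoeff k x y = 1 ∨ (swapCoeff k x y = -1 ∧ pos x / 2 = pos y / 2))) := by
    intro x y hxy
    rcases lt_or_gt_of_ne hxy with h | h
    · exact Or.inl ⟨h, orderSign_of_lt h, swapCoeff_of_lt h⟩
    · exact Or.inr ⟨h, orderSign_of_gt h, swapCoeff_of_gt h⟩
  have h₁ := (hv x y).trans (bracketValue_of_ne a hxy)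
  have h₂ := (hv y z).trans (bracketValue_of_ne a hyz)
  have h₃ := (hv z x).trans (bracketValue_of_ne a hzx)
  refine h.tripleBracket_of_quadraticTerm h₁ h₂ h₃ ?_ ?_ ?_ ?_ ?_ ?_ ?_ ?_ <;>
  rcases signs x y hxy with ⟨o₁, s₁, ⟨t₁⟩ | ⟨t₁, d₁⟩⟩ | ⟨o₁, s₁, ⟨t₁⟩ | ⟨t₁, d₁⟩⟩ <;>
  rcases signs y z hyz with ⟨o₂, s₂, ⟨t₂⟩ | ⟨t₂, d₂⟩⟩ | ⟨o₂, s₂, ⟨t₂⟩ | ⟨t₂, d₂⟩⟩ <;>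
  rcases signs z x hzx with ⟨o₃, s₃, ⟨t₃⟩ | ⟨t₃, d₃⟩⟩ | ⟨o₃, s₃, ⟨t₃⟩ | ⟨t₃, d₃⟩⟩ <;>
  first
  -- Excluded are cyclic orders such as `x < y < z < x` and a generator lying between an adjacent
  -- irregular pair.
  | (exfalso; omega)
  | (simp only [s₁, s₂, s₃, t₁, t₂, t₃]; ring)

end SurfaceFreeGen

end SurfaceBrackets

/-! ### Fusion calculus and the moment map equation -/

section MomentMaps

open TensorProduct

variable {k A : Type*} [Field k] [Ring A] [Algebra k A] {ι : Type*} {e : ι → A}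
  {br : A →ₗ[k] A →ₗ[k] A ⊗[k] A}

/-- `fusionTerm` is an inner derivation in its first argument, just like a double bracket. Hence the
elements `u` with `br u a = c • fusionTerm k u a` are closed under products. -/
theorem fusionTerm_mul (u v a : A) : fusionTerm k (u * v) a =
    (1 ⊗ₜ[k] u) * fusionTerm k v a + fusionTerm k u a * (v ⊗ₜ[k] 1) := by
  unfold fusionTerm
  simp only [smul_mul_assoc, mul_smul_comm, mul_add, add_mul, mul_sub, sub_mul,
    Algebra.TensorProduct.tmul_mul_tmul, mul_one, one_mul, mul_assoc]
  module

theorem fusionTerm_one (a : A) : fusionTerm k 1 a = 0 := by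
  unfold fusionTerm
  simp only [mul_one, one_mul]
  module

/-- Together with `momentTerm_mul_fusionTerm`, this absorbs factors of sign `+1` on the left and
`-1` on the right into a moment term. -/
theorem fusionTerm_mul_momentTerm (u v a : A) : momentTerm k (u * v) a =
    (1 ⊗ₜ[k] u) * momentTerm k v a + fusionTerm k u a * (v ⊗ₜ[k] 1) := by
  unfold fusionTerm momentTerm
  simp only [smul_mul_assoc, mul_smul_comm, mul_add, add_mul, mul_sub, sub_mul,
    Algebra.TensorProduct.tmul_mul_tmul, mul_one, one_mul, mul_assoc]
  module

theorem momentTerm_mul_fusionTerm (u v a : A) : momentTerm k (u * v) a =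
    (1 ⊗ₜ[k] u) * ((-1 : k) • fusionTerm k v a) + momentTerm k u a * (v ⊗ₜ[k] 1) := by
  unfold fusionTerm momentTerm
  simp only [smul_mul_assoc, mul_smul_comm, mul_add, add_mul, mul_sub, sub_mul,
    Algebra.TensorProduct.tmul_mul_tmul, mul_one, one_mul, mul_assoc]
  module

namespace IsDoubleBracket

/-- Apply the inner Leibniz rule to `u * u⁻¹ = 1`, whose bracket vanishes. -/
theorem inv_left (h : IsDoubleBracket e br) (u : Aˣ) (a : A) :
    br (↑u⁻¹ : A) a =
      (-1 : k) • ((1 ⊗ₜ[k] (↑u⁻¹ : A)) * br (u : A) a * ((↑u⁻¹ : A) ⊗ₜ[k] 1)) := by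
  have h₁ := h.leibniz_left (u : A) (↑u⁻¹ : A) a
  rw [Units.mul_inv, h.one_left] at h₁
  have h₂ := congrArg (fun x => ((1 : A) ⊗ₜ[k] (↑u⁻¹ : A)) * x) h₁
  simp only [mul_zero, mul_add, ← mul_assoc, Algebra.TensorProduct.tmul_mul_tmul, Units.inv_mul,
    one_mul] at h₂
  rw [← Algebra.TensorProduct.one_def, one_mul] at h₂
  rw [neg_one_smul]
  exact eq_neg_of_add_eq_zero_left h₂.symm

theorem fusion_mul (h : IsDoubleBracket e br) {c : k} {u v a : A}
    (hu : br u a = c • fusionTerm k u a) (hv : br v a = c • fusionTerm k v a) :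
    br (u * v) a = c • fusionTerm k (u * v) a := by
  rw [h.leibniz_left, hu, hv, fusionTerm_mul, smul_add, smul_mul_assoc, mul_smul_comm]

theorem fusion_inv (h : IsDoubleBracket e br) {c : k} {u : Aˣ} {a : A}
    (hu : br (u : A) a = c • fusionTerm k (u : A) a) :
    br (↑u⁻¹ : A) a = c • fusionTerm k (↑u⁻¹ : A) a := by
  rw [h.inv_left, hu]
  unfold fusionTerm
  simp only [smul_mul_assoc, mul_smul_comm, mul_add, add_mul, mul_sub, sub_mul,
    Algebra.TensorProduct.tmul_mul_tmul, mul_one, one_mul, mul_assoc, Units.mul_inv, Units.inv_mul,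
    Units.inv_mul_cancel_left]
  module

theorem fusion_commutator (h : IsDoubleBracket e br) {c : k} {u v : Aˣ} {a : A}
    (hu : br (u : A) a = c • fusionTerm k (u : A) a)
    (hv : br (v : A) a = c • fusionTerm k (v : A) a) :
    br (↑(u * v * u⁻¹ * v⁻¹) : A) a = c • fusionTerm k (↑(u * v * u⁻¹ * v⁻¹) : A) a := by
  simp only [Units.val_mul]
  exact h.fusion_mul (h.fusion_mul (h.fusion_mul hu hv) (h.fusion_inv hu)) (h.fusion_inv hv)

theorem fusion_list_prod (h : IsDoubleBracket e br) {c : k} {a : A} (l : List Aˣ)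
    (hl : ∀ u ∈ l, br (u : A) a = c • fusionTerm k (u : A) a) :
    br (l.prod : A) a = c • fusionTerm k (l.prod : A) a := by
  induction l with
  | nil => simp [h.one_left, fusionTerm_one]
  | cons u l ih =>
    rw [List.prod_cons, Units.val_mul]
    exact h.fusion_mul (hl u (by simp)) (ih fun v hv => hl v (by simp [hv]))

theorem moment_fusion_left (h : IsDoubleBracket e br) {u v a : A}
    (hu : br u a = (1 : k) • fusionTerm k u a) (hv : br v a = momentTerm k v a) :
    br (u * v) a = momentTerm k (u * v) a := by
  rw [h.leibniz_left, hu, hv, fusionTerm_mul_momentTerm, one_smul]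

theorem moment_fusion_right (h : IsDoubleBracket e br) {u v a : A}
    (hu : br u a = momentTerm k u a) (hv : br v a = (-1 : k) • fusionTerm k v a) :
    br (u * v) a = momentTerm k (u * v) a := by
  rw [h.leibniz_left, hu, hv, momentTerm_mul_fusionTerm]

theorem moment_ofFn_prod (h : IsDoubleBracket e br) {a : A} {n : ℕ} (f : Fin n → Aˣ) (i : Fin n)
    (hlt : ∀ j < i, br (f j : A) a = (1 : k) • fusionTerm k (f j : A) a)
    (hi : br (f i : A) a = momentTerm k (f i : A) a)
    (hgt : ∀ j > i, br (f j : A) a = (-1 : k) • fusionTerm k (f j : A) a) :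
    br ((List.ofFn f).prod : A) a = momentTerm k ((List.ofFn f).prod : A) a := by
  induction n with
  | zero => exact i.elim0
  | succ n ih =>
    rw [List.ofFn_succ, List.prod_cons, Units.val_mul]
    cases i using Fin.cases with
    | zero =>
      refine h.moment_fusion_right hi (h.fusion_list_prod _ fun u hu => ?_)
      obtain ⟨j, rfl⟩ := (List.mem_ofFn' _ _).1 hu
      exact hgt _ (Fin.succ_pos j)
    | succ i =>
      exact h.moment_fusion_left (hlt 0 (Fin.succ_pos i))
        (ih (fun j => f j.succ) i (fun j hj => hlt _ (Fin.succ_lt_succ_iff.2 hj)) hi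
          fun j hj => hgt _ (Fin.succ_lt_succ_iff.2 hj))

/-- The one-handle computation: in the expansion of the commutator by the inner Leibniz rule the
terms telescope. The irregular sign in the bracket of `αᵢ` and `βᵢ` enters here. -/
theorem moment_commutator_left (h : IsDoubleBracket e br) {u v : Aˣ}
    (huu : br (u : A) (u : A) = quadraticTerm 1 (-1) 0 0 (u : A) (u : A))
    (huv : br (u : A) (v : A) = quadraticTerm 1 1 (-1) 1 (u : A) (v : A)) :
    br (↑(u * v * u⁻¹ * v⁻¹) : A) (u : A) =
      momentTerm k (↑(u * v * u⁻¹ * v⁻¹) : A) (u : A) := by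
  have hvu : br (v : A) (u : A) = quadraticTerm (-1) (-1) 1 (-1) (v : A) (u : A) := by
    rw [h.antisymm, huv, comm_quadraticTerm, neg_quadraticTerm, neg_neg]
  simp only [Units.val_mul, h.leibniz_left, h.inv_left, huu, hvu]
  unfold quadraticTerm momentTerm
  simp only [smul_mul_assoc, mul_smul_comm, mul_add, add_mul, smul_add,
    Algebra.TensorProduct.tmul_mul_tmul, mul_one, one_mul, mul_assoc, Units.mul_inv, Units.inv_mul,
    Units.inv_mul_cancel_left]
  module

theorem moment_commutator_right (h : IsDoubleBracket e br) {u v : Aˣ}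
    (hvv : br (v : A) (v : A) = quadraticTerm (-1) 1 0 0 (v : A) (v : A))
    (huv : br (u : A) (v : A) = quadraticTerm 1 1 (-1) 1 (u : A) (v : A)) :
    br (↑(u * v * u⁻¹ * v⁻¹) : A) (v : A) =
      momentTerm k (↑(u * v * u⁻¹ * v⁻¹) : A) (v : A) := by
  simp only [Units.val_mul, h.leibniz_left, h.inv_left, hvv, huv]
  unfold quadraticTerm momentTerm
  simp only [smul_mul_assoc, mul_smul_comm, mul_add, add_mul, smul_add,
    Algebra.TensorProduct.tmul_mul_tmul, mul_one, one_mul, mul_assoc, Units.mul_inv, Units.inv_mul,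
    Units.inv_mul_cancel_left]
  module

end IsDoubleBracket

/-! ### The boundary word and elimination of `Φ` -/

namespace SurfaceFreeGen

variable {g r : ℕ}

/-- The product `[α₁, β₁] ⋯ [α_g, β_g] γ₁ ⋯ γ_r`. -/
def boundaryProd {G : Type*} [Group G] (u : SurfaceFreeGen g r → G) : G :=
  (List.ofFn fun i : Fin g =>
      u (alpha i) * u (beta i) * (u (alpha i))⁻¹ * (u (beta i))⁻¹).prod
    * (List.ofFn fun l : Fin r => u (gamma l)).prod

theorem map_boundaryProd {G H : Type*} [Group G] [Group H] (f : G →* H)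
    (u : SurfaceFreeGen g r → G) : f (boundaryProd u) = boundaryProd fun x => f (u x) := by
  simp only [boundaryProd, map_mul, map_list_prod, List.map_ofFn, Function.comp_def, map_inv]

theorem moment_boundaryProd (h : IsDoubleBracket e br) (u : SurfaceFreeGen g r → Aˣ)
    (hv : ∀ x y, br (u x : A) (u y : A) = bracketValue k (fun z => (u z : A)) x y)
    (y : SurfaceFreeGen g r) :
    br ((boundaryProd u : Aˣ) : A) (u y : A) =
      momentTerm k ((boundaryProd u : Aˣ) : A) (u y : A) := by
  have lt_case : ∀ x, pos x < pos y → pos x / 2 ≠ pos y / 2 →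
      br (u x : A) (u y : A) = (1 : k) • fusionTerm k (u x : A) (u y : A) := fun x h₁ h₂ => by
    rw [hv, bracketValue_of_lt _ h₁ h₂, one_smul]
  have gt_case : ∀ x, pos y < pos x → pos x / 2 ≠ pos y / 2 →
      br (u x : A) (u y : A) = (-1 : k) • fusionTerm k (u x : A) (u y : A) := fun x h₁ h₂ => by
    rw [hv, bracketValue_of_gt _ h₁ h₂]
  -- If `y` lies on handle `i`, earlier commutators contribute `+fusionTerm`, later ones and all
  -- `γ`'s contribute `-fusionTerm`, so only the commutator of handle `i` is left to check.
  have handle : ∀ i : Fin g, (pos y = 2 * i ∨ pos y = 2 * i + 1) →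
      br (u (alpha i) * u (beta i) * (u (alpha i))⁻¹ * (u (beta i))⁻¹ : Aˣ) (u y : A) =
        momentTerm k (↑(u (alpha i) * u (beta i) * (u (alpha i))⁻¹ * (u (beta i))⁻¹) : A)
          (u y : A) →
      br ((boundaryProd u : Aˣ) : A) (u y : A) =
      momentTerm k ((boundaryProd u : Aˣ) : A) (u y : A) := by
    intro i hi hm
    simp only [pos] at hi
    rw [boundaryProd, Units.val_mul]
    refine h.moment_fusion_right (h.moment_ofFn_prod _ i (fun j hj => ?_) hm fun j hj => ?_)
      (h.fusion_list_prod _ fun w hw => ?_)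
    · rw [Fin.lt_def] at hj
      exact h.fusion_commutator
        (lt_case _ (by simp only [pos]; omega) (by simp only [pos]; omega))
        (lt_case _ (by simp only [pos]; omega) (by simp only [pos]; omega))
    · rw [gt_iff_lt, Fin.lt_def] at hj
      exact h.fusion_commutator
        (gt_case _ (by simp only [pos]; omega) (by simp only [pos]; omega))
        (gt_case _ (by simp only [pos]; omega) (by simp only [pos]; omega))
    · obtain ⟨l, rfl⟩ := (List.mem_ofFn' _ _).1 hw
      exact gt_case _ (by simp only [pos]; omega) (by simp only [pos]; omega)
  cases y with
  | alpha i =>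
    exact handle i (Or.inl rfl) (h.moment_commutator_left
      ((hv _ _).trans (bracketValue_self _ _)) ((hv _ _).trans (bracketValue_alpha_beta _ _)))
  | beta i =>
    refine handle i (Or.inr rfl) (h.moment_commutator_right
      ((hv _ _).trans ((bracketValue_self _ _).trans ?_))
      ((hv _ _).trans (bracketValue_alpha_beta _ _)))
    rw [selfSign, neg_neg]
  | gamma l =>
    rw [boundaryProd, Units.val_mul]
    refine h.moment_fusion_left (h.fusion_list_prod _ fun w hw => ?_)
      (h.moment_ofFn_prod _ l (fun j hj => ?_) ?_ fun j hj => ?_)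
    · obtain ⟨i, rfl⟩ := (List.mem_ofFn' _ _).1 hw
      exact h.fusion_commutator
        (lt_case _ (by simp only [pos]; omega) (by simp only [pos]; omega))
        (lt_case _ (by simp only [pos]; omega) (by simp only [pos]; omega))
    · rw [hv, bracketValue_gamma_gamma _ hj, one_smul]
    -- For `u = a` the mixed terms of `momentTerm` cancel, leaving exactly the self-bracket of `γₗ`.
    · rw [hv, bracketValue_self]
      unfold quadraticTerm momentTerm selfSign
      module
    · rw [hv, bracketValue_gamma_gamma' _ hj]

/-- The inclusion of the free generators into all generators. -/
def toSurfaceGen : SurfaceFreeGen g r → SurfaceGen g r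
  | alpha i => .alpha i
  | beta i => .beta i
  | gamma l => .gamma l

/-- The images of the generators of a surface group in the free group on `αᵢ, βᵢ, γₗ`. -/
def eliminatePhi : SurfaceGen g r → FreeGroup (SurfaceFreeGen g r)
  | .alpha i => FreeGroup.of (alpha i)
  | .beta i => FreeGroup.of (beta i)
  | .gamma l => FreeGroup.of (gamma l)
  | .phi => boundaryProd FreeGroup.of

theorem eliminatePhi_toSurfaceGen (x : SurfaceFreeGen g r) :
    eliminatePhi (toSurfaceGen x) = FreeGroup.of x := by
  cases x <;> rfl

theorem surfaceRelator_eq : surfaceRelator g r =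
    boundaryProd (fun x => FreeGroup.of (toSurfaceGen x)) * (FreeGroup.of .phi)⁻¹ := rfl

theorem lift_eliminatePhi_surfaceRelator :
    ∀ w ∈ ({surfaceRelator g r} : Set _), FreeGroup.lift eliminatePhi w = 1 := by
  rintro _ rfl
  rw [surfaceRelator_eq, map_mul, map_inv, map_boundaryProd]
  simp only [FreeGroup.lift_apply_of, eliminatePhi_toSurfaceGen]
  exact mul_inv_cancel _

theorem boundaryProd_of : boundaryProd (fun x : SurfaceFreeGen g r =>
    (PresentedGroup.of (toSurfaceGen x) : SurfaceGroup g r)) = PresentedGroup.of .phi := by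
  have h := PresentedGroup.one_of_mem (Set.mem_singleton (surfaceRelator g r))
  rw [surfaceRelator_eq, map_mul, map_inv, map_boundaryProd] at h
  exact mul_inv_eq_one.1 h

/-- A surface group is free on the generators `αᵢ, βᵢ, γₗ`. -/
def surfaceGroupEquiv : SurfaceGroup g r ≃* FreeGroup (SurfaceFreeGen g r) :=
  MonoidHom.toMulEquiv (PresentedGroup.toGroup lift_eliminatePhi_surfaceRelator)
    (FreeGroup.lift fun x => PresentedGroup.of (toSurfaceGen x))
    (by
      refine PresentedGroup.ext fun x => ?_
      rw [MonoidHom.comp_apply, PresentedGroup.toGroup.of, MonoidHom.id_apply]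
      cases x with
      | phi =>
        rw [eliminatePhi, map_boundaryProd]
        simp only [FreeGroup.lift_apply_of]
        exact boundaryProd_of
      | alpha i => exact FreeGroup.lift_apply_of
      | beta i => exact FreeGroup.lift_apply_of
      | gamma l => exact FreeGroup.lift_apply_of)
    (by
      refine FreeGroup.ext_hom _ _ fun x => ?_
      rw [MonoidHom.comp_apply, FreeGroup.lift_apply_of, PresentedGroup.toGroup.of,
        eliminatePhi_toSurfaceGen, MonoidHom.id_apply])

/-- The free basis given by a standard presentation. -/
def basis {π : Type*} [Group π] (e : SurfaceGroup g r ≃* π) :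
    FreeGroupBasis (SurfaceFreeGen g r) π :=
  FreeGroupBasis.ofRepr (e.symm.trans surfaceGroupEquiv)

theorem basis_apply {π : Type*} [Group π] (e : SurfaceGroup g r ≃* π) (x : SurfaceFreeGen g r) :
    basis e x = e (PresentedGroup.of (toSurfaceGen x)) := by
  apply (basis e).repr.injective
  rw [FreeGroupBasis.repr_apply_coe]
  change _ = surfaceGroupEquiv (e.symm (e (PresentedGroup.of (toSurfaceGen x))))
  rw [MulEquiv.symm_apply_apply, ← eliminatePhi_toSurfaceGen]
  exact (PresentedGroup.toGroup.of lift_eliminatePhi_surfaceRelator).symm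

theorem boundaryProd_basis {π : Type*} [Group π] (e : SurfaceGroup g r ≃* π) :
    boundaryProd (basis e) = e (PresentedGroup.of .phi) := by
  rw [← boundaryProd_of, ← MulEquiv.coe_toMonoidHom, map_boundaryProd]
  exact congrArg boundaryProd (funext (basis_apply e))

end SurfaceFreeGen

end MomentMaps

/-! ### Assembly of the theorem -/

open SurfaceFreeGen in
theorem hasStandardQuasiHamiltonianStructure (k : Type*) [Field k] {g r : ℕ} {π : Type*} [Group π]
    (e : SurfaceGroup g r ≃* π) : HasStandardQuasiHamiltonianStructure k e := by
  let b := basis e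
  let a : SurfaceFreeGen g r → MonoidAlgebra k π := fun x => MonoidAlgebra.of k π (b x)
  let Φ : MonoidAlgebra k π := MonoidAlgebra.of k π (e (PresentedGroup.of .phi))
  obtain ⟨br, hbr, hv⟩ := exists_isDoubleBracket b (bracketValue k a) (bracketValue_antisymm a)
  have ha : ∀ x, MonoidAlgebra.of k π (e (PresentedGroup.of (toSurfaceGen x))) = a x := fun x => by
    rw [← basis_apply]
  have hα : (fun i : Fin g => MonoidAlgebra.of k π (e (PresentedGroup.of (.alpha i)))) =
      fun i => a (alpha i) := funext fun i => ha (alpha i)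
  have hβ : (fun i : Fin g => MonoidAlgebra.of k π (e (PresentedGroup.of (.beta i)))) =
      fun i => a (beta i) := funext fun i => ha (beta i)
  have hγ : (fun l : Fin r => MonoidAlgebra.of k π (e (PresentedGroup.of (.gamma l)))) =
      fun l => a (gamma l) := funext fun l => ha (gamma l)
  -- Passing to units gives meaning in the algebra to the group word `boundaryProd`, which contains
  -- inverses.
  let u : π →* (MonoidAlgebra k π)ˣ := (MonoidAlgebra.of k π).toHomUnits
  have hΦ : (boundaryProd (fun x => u (b x)) : (MonoidAlgebra k π)ˣ) = Φ := by
    rw [← map_boundaryProd u]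
    exact congrArg (MonoidAlgebra.of k π) (boundaryProd_basis e)
  have moment_gen : ∀ x, br Φ (a x) = momentTerm k Φ (a x) := fun x => by
    rw [← hΦ]
    exact moment_boundaryProd hbr (fun x => u (b x)) hv x
  have moment : ∀ c, br Φ c = momentTerm k Φ c :=
    hbr.moment_of_closure b.closure_range Φ (by rintro _ ⟨x, rfl⟩; exact moment_gen x)
  have quasi : IsDoubleQuasiPoisson (fun _ : Unit => (1 : MonoidAlgebra k π)) br :=
    { idempotents :=
        { idem := fun _ => one_mul 1
          ortho := fun i j hij => (hij (Subsingleton.elim i j)).elim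
          complete := by simp }
      bracket := hbr
      quasiPoisson := fun x y z => by
        have := hbr.quasiPoisson_of_closure b.closure_range (by
          rintro _ ⟨x, rfl⟩ _ ⟨y, rfl⟩ _ ⟨z, rfl⟩
          exact tripleBracket_eq hbr a hv x y z) x y z
        simpa only [quasiPoissonTerm, Finset.univ_unique, Finset.sum_singleton, mul_one, one_mul] using this }
  have hmoment : IsMultiplicativeMomentMap (fun _ : Unit => (1 : MonoidAlgebra k π)) br Φ :=
    { isUnit := (Group.isUnit _).map (MonoidAlgebra.of k π)
      diagonal := by simp
      moment := fun _ c => by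
        simpa only [momentTerm, mul_one, one_mul] using moment c }
  refine ⟨br, quasi, ?_, fun br' hbr' hv' => ?_, fun c _ => moment c, hmoment, quasi, hmoment⟩
  · rw [hα, hβ, hγ]
    exact hasMassuyeauTuraevValues_of_bracketValue a hv
  · rw [hα, hβ, hγ] at hv'
    refine hbr'.ext_of_closure hbr b.closure_range ?_
    rintro _ ⟨x, rfl⟩ _ ⟨y, rfl⟩
    exact (bracketValue_eq_of_hasMassuyeauTuraevValues hbr' a hv' x y).trans (hv x y).symm

/-- A standard presentation of the loop group is an isomorphism from `SurfaceGroup g r`, so the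
surface case is an instance of the group case. -/
theorem mainTheorem4 (k : Type*) [Field k] [CharZero k] (g r : ℕ) :
    (∀ (π : Type*) [Group π] (e : SurfaceGroup g r ≃* π),
      HasStandardQuasiHamiltonianStructure k e) ∧
    (∀ (S : Type*) [TopologicalSpace S] [ChartedSpace (EuclideanHalfSpace 2) S],
      IsCompactOrientedSurface S (r + 1) →
      ∀ x ∈ (𝓡∂ 2).boundary S, ∀ e : SurfaceGroup g r ≃* LoopGroup S x,
        (∃ p : Path x x, IsBoundaryLoop p ∧ e (PresentedGroup.of .phi) = loopClass p) →
          HasStandardQuasiHamiltonianStructure k e) :=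
  ⟨fun _ _ e => hasStandardQuasiHamiltonianStructure k e,
    fun _ _ _ _ _ _ e _ => hasStandardQuasiHamiltonianStructure k e⟩
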